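/- **Theorem (dual isomorphism).** *Setting.* Let $\mathcal L$ be either the language $(\wedge,\vee,\to,0,1)$ of intuitionistic logic or the language $(\wedge,\vee,\neg,0,1,(\Diamond_i)_{i\in I})$ of modal logic, where we put $a\to b:=\neg a\vee b$, $a\leftrightarrow b:=(a\to b)\wedge(b\to a)$ and $\Box_i a:=\neg\Diamond_i\neg a$. Let $\mathsf{Prop}$ be an infinite set of propositional variables; formulas are $\mathcal L$-terms over $\mathsf{Prop}$. Let $\mathsf L$ be a superintuitionistic logic (a set of formulas that contains the intuitionistic propositional calculus and is closed under modus ponens and substitution), respectively a normal modal logic (a set of formulas that contains all classical tautologies, $\Box_i(a\to b)\to(\Box_i a\to\Box_i b)$ and $\Diamond_i a\leftrightarrow\neg\Box_i\neg a$, and is closed under modus ponens, substitution and necessitation). An *$\mathsf L$-algebra* is a Heyting algebra, respectively a modal algebra (a Boolean algebra with operations $\Diamond_i$ such that $\Diamond_i0=0$ and $\Diamond_i(x\vee y)=\Diamond_i x\vee\Diamond_i y$), in which every formula of $\mathsf L$ has the value $1$ under every valuation. *Rules.* A *$\Pi_2$-rule* $\tilde\forall\bar p\,\Gamma/^2\psi$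 is a triple $(\Gamma,\psi,F)$ of a finite set $\Gamma$ of formulas, a formula $\psi$, and a finite set $F=\{\bar p\}$ of variables ("bound" variables) that do not occur in $\psi$. A variable occurs *free* in $\Gamma$ if it occurs in $\Gamma$ and is not in $F$. An algebra $\mathcal A$ validates the rule if for every valuation $v:\mathsf{Prop}\to A$: if $v'(\phi)=1$ for all $\phi\in\Gamma$ and all valuations $v'$ that agree with $v$ outside $F$, then $v(\psi)=1$. A set $\vdash$ of $\Pi_2$-rules is a *$\Pi_2$-rule system* if it satisfies the following conditions (all triples mentioned being $\Pi_2$-rules). * Strong reflexivity: $\tilde\forall\bar p\,\Gamma\vdash\chi[\bar\phi/\bar p]$ for $\chi\in\Gamma$ and formulas $\bar\phi$ in which no variable of $\bar p$ occurs. * Monotonicity: if $\tilde\forall\bar p\,\Gamma\vdash\psi$, then $\tilde\forall\bar p\,(\Gamma\cup\Gamma')\vdash\psi$ for every finite set $\Gamma'$ of formulas. * $\alpha$-renaming: if $\tilde\forall\bar p\,\Gamma\vdash\psi$ and $\bar q$ are pairwise distinct variables, as many as $\bar p$, that do not occur free in $\Gamma$ and do not occur in $\psi$, then $\tilde\forall\bar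 q\,\Gamma[\bar q/\bar p]\vdash\psi$. * Rule cut: if $\tilde\forall\bar p\,\Gamma\vdash\mu$ for every $\mu\in\Delta$, and $\tilde\forall\bar q\,\Delta\vdash\psi$, where $\psi$ contains no variable of $\bar p$ or $\bar q$ and $\Gamma$ contains no variable of $\bar q$, then $\tilde\forall\bar p\,\Gamma\vdash\psi$. * Bound structurality: if $\tilde\forall\bar p\,\Gamma\vdash\psi$, and $\sigma$ is a substitution that fixes every variable of $\bar p$ and is such that no variable of $\bar p$ occurs in $\sigma(\psi)$, nor in $\sigma(q)$ for any variable $q$ outside $\bar p$ that occurs in $\Gamma$, $\sigma[\Gamma]$ or $\sigma(\psi)$, then $\tilde\forall\bar p\,\sigma[\Gamma]\vdash\sigma(\psi)$. It *extends $\mathsf L$* if it contains the rules $\emptyset/\phi$ for $\phi\in\mathsf L$, modus ponens $\{a,a\to b\}/b$ and, in the modal case, necessitation $\{a\}/\Box_i a$ (all without bound variables). *Classes.* A *$\forall$-embedding* $f:\mathcal A\to\mathcal B$ is an embedding such that $\mathcal A\vDash\forall\bar x\,\phi(\bar x,\bar a)$ implies $\mathcal B\vDash\forall\bar x\,\phi(\bar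 x,f(\bar a))$ for every atomic formula $\phi$ and every tuple $\bar a$ in $A$; then $\mathcal A$ is an isomorphic copy of a $\forall$-subalgebra of $\mathcal B$. An *inductive rule class* is a class of $\mathsf L$-algebras that is closed under isomorphic copies of $\forall$-subalgebras, of direct products (the empty product included) and of ultraproducts. For a class $\mathbf K$, let $\mathbb R^{\mathbb I}(\mathbf K)$ be the smallest inductive rule class that contains $\mathbf K$, and $\Pi_2(\mathbf K)$ the set of all $\Pi_2$-rules valid in every member of $\mathbf K$. For a set $S$ of $\Pi_2$-rules, let $Ind(S)$ be the class of all $\mathsf L$-algebras that validate every rule of $S$. *Claim.* The $\Pi_2$-rule systems extending $\mathsf L$ form a lattice under inclusion, with meet $S\cap T$ and join $S\vee T$ the smallest $\Pi_2$-rule system that contains $S\cup T$; the inductive rule classes of $\mathsf L$-algebras form a lattice under inclusion, with meet $\mathbf K\cap\mathbf M$ and join $\mathbb R^{\mathbb I}(\mathbf K\cup\mathbf M)$. The map $Ind$ is an order-reversing bijection (a dual isomorphism, reversing the order in both directions) from the first lattice onto the second, with inverse $\Pi_2$. In particular, for all $\Pi_2$-rule systems $S,T$ extending $\mathsf L$,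 $$Ind(S\cap T)=\mathbb R^{\mathbb I}(Ind(S)\cup Ind(T)),\qquad Ind(S\vee T)=Ind(S)\cap Ind(T).$$ -/

import Mathlib

open FirstOrder

universe u

namespace PiTwo

/-! ### General syntax: `Π₂`-rules over an algebraic language -/

section Rules

variable {ℒ : FirstOrder.Language.{u, 0}} {V : Type u}

/-- The set of variables occurring in a formula. A propositional formula of an algebraic language
is a term over the set `V` of propositional variables. -/
def vars (φ : ℒ.Term V) : Set V :=
  letI := Classical.decEq V
  ↑φ.varFinset

/-- The set of variables occurring in some formula of `Γ`. -/
def varsOf (Γ : Set (ℒ.Term V)) : Set V := ⋃ φ ∈ Γ, vars φ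

/-- `σ[Γ] = {σ(φ) : φ ∈ Γ}`. -/
def substSet (σ : V → ℒ.Term V) (Γ : Set (ℒ.Term V)) : Set (ℒ.Term V) :=
  (fun φ => φ.subst σ) '' Γ

variable (ℒ V) in
/-- A `Π₂`-rule `(Γ, ψ, F)`: a finite set `Γ` of premises, a conclusion `ψ`, and a finite set `F`
of (bound) variables, none of which occurs in `ψ`. -/
@[ext]
structure Pi2Rule where
  prem : Set (ℒ.Term V)
  concl : ℒ.Term V
  bound : Set V
  prem_finite : prem.Finite
  bound_finite : bound.Finite
  bound_concl : Disjoint bound (vars concl)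

/-- A `Π₁`-rule `Γ ⊢ ψ`, i.e. a `Π₂`-rule without bound variables. -/
def pi1Rule (Γ : Set (ℒ.Term V)) (hΓ : Γ.Finite) (ψ : ℒ.Term V) : Pi2Rule ℒ V :=
  ⟨Γ, ψ, ∅, hΓ, Set.finite_empty, Set.empty_disjoint _⟩

/-- The closure conditions that define a `Π₂`-rule system. In each of them the rule `r`, being a
`Π₂`-rule, satisfies `Disjoint r.bound (vars r.concl)`. -/
structure IsPi2RuleSystem (S : Set (Pi2Rule ℒ V)) : Prop where
  /-- Strong reflexivity: `∀p̄ Γ ⊢ χ[φ̄/p̄]` for `χ ∈ Γ`, if no variable of `p̄` occurs in `φ̄`. -/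
  strong_reflexivity : ∀ (r : Pi2Rule ℒ V) (χ : ℒ.Term V) (σ : V → ℒ.Term V),
    χ ∈ r.prem →
    (∀ p ∉ r.bound, σ p = .var p) →
    (∀ p ∈ r.bound, Disjoint r.bound (vars (σ p))) →
    r.concl = χ.subst σ → r ∈ S
  /-- Monotonicity: from `∀p̄ Γ ⊢ ψ` to `∀p̄ (Γ, Γ') ⊢ ψ`. -/
  monotonicity : ∀ (r₀ r : Pi2Rule ℒ V), r₀ ∈ S →
    r₀.prem ⊆ r.prem → r.bound = r₀.bound → r.concl = r₀.concl → r ∈ S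
  /-- `α`-renaming: from `∀p̄ Γ ⊢ ψ` to `∀q̄ Γ[q̄/p̄] ⊢ ψ`, if the `qᵢ` are distinct and do not occur
  free in `Γ` or `ψ`. -/
  alpha_renaming : ∀ (r₀ r : Pi2Rule ℒ V) (ρ : V → V), r₀ ∈ S →
    Set.InjOn ρ r₀.bound →
    (∀ p ∉ r₀.bound, ρ p = p) →
    Disjoint (ρ '' r₀.bound) (varsOf r₀.prem \ r₀.bound) →
    Disjoint (ρ '' r₀.bound) (vars r₀.concl) →
    r.prem = substSet (fun p => .var (ρ p)) r₀.prem →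
    r.bound = ρ '' r₀.bound → r.concl = r₀.concl → r ∈ S
  /-- Rule cut: from `∀p̄ Γ ⊢ μ` for all `μ ∈ Δ` and `∀q̄ Δ ⊢ ψ` to `∀p̄ Γ ⊢ ψ`, if no variable of
  `q̄` occurs in `Γ` (and `ψ` contains no variable of `p̄` or `q̄`). -/
  rule_cut : ∀ (d r : Pi2Rule ℒ V), d ∈ S →
    (∀ μ ∈ d.prem, ∃ g ∈ S, g.prem = r.prem ∧ g.bound = r.bound ∧ g.concl = μ) →
    Disjoint d.bound (varsOf r.prem) →
    r.concl = d.concl → r ∈ S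
  /-- Bound structurality: from `∀p̄ Γ ⊢ ψ` to `∀p̄ σ[Γ] ⊢ σ(ψ)`, if `σ` fixes `p̄` and no variable
  of `p̄` occurs in `σ(q)` for `q` free in `Γ`, `σ[Γ]` or `σ(ψ)`. -/
  bound_structurality : ∀ (r₀ r : Pi2Rule ℒ V) (σ : V → ℒ.Term V), r₀ ∈ S →
    (∀ p ∈ r₀.bound, σ p = .var p) →
    (∀ q ∈ (varsOf r₀.prem ∪ varsOf (substSet σ r₀.prem) ∪ vars (r₀.concl.subst σ)) \ r₀.bound,
      Disjoint r₀.bound (vars (σ q))) →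
    r.prem = substSet σ r₀.prem →
    r.bound = r₀.bound → r.concl = r₀.concl.subst σ → r ∈ S

/-- `ruleClosure B` is the smallest `Π₂`-rule system that contains the set of rules `B`. -/
def ruleClosure (B : Set (Pi2Rule ℒ V)) : Set (Pi2Rule ℒ V) :=
  ⋂₀ {S | IsPi2RuleSystem S ∧ B ⊆ S}

theorem isPi2RuleSystem_sInter {𝒮 : Set (Set (Pi2Rule ℒ V))}
    (h : ∀ S ∈ 𝒮, IsPi2RuleSystem S) : IsPi2RuleSystem (⋂₀ 𝒮) where
  strong_reflexivity r χ σ h₁ h₂ h₃ h₄ S hS := (h S hS).strong_reflexivity r χ σ h₁ h₂ h₃ h₄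
  monotonicity r₀ r h₀ h₁ h₂ h₃ S hS := (h S hS).monotonicity r₀ r (h₀ S hS) h₁ h₂ h₃
  alpha_renaming r₀ r ρ h₀ h₁ h₂ h₃ h₄ h₅ h₆ h₇ S hS :=
    (h S hS).alpha_renaming r₀ r ρ (h₀ S hS) h₁ h₂ h₃ h₄ h₅ h₆ h₇
  rule_cut d r h₀ h₁ h₂ h₃ S hS := (h S hS).rule_cut d r (h₀ S hS)
    (fun μ hμ => (h₁ μ hμ).imp fun _ hg => ⟨hg.1 S hS, hg.2⟩) h₂ h₃
  bound_structurality r₀ r σ h₀ h₁ h₂ h₃ h₄ h₅ S hS :=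
    (h S hS).bound_structurality r₀ r σ (h₀ S hS) h₁ h₂ h₃ h₄ h₅

theorem isPi2RuleSystem_ruleClosure (B : Set (Pi2Rule ℒ V)) : IsPi2RuleSystem (ruleClosure B) :=
  isPi2RuleSystem_sInter fun _ hS => hS.1

theorem isPi2RuleSystem_inter {S T : Set (Pi2Rule ℒ V)} (hS : IsPi2RuleSystem S)
    (hT : IsPi2RuleSystem T) : IsPi2RuleSystem (S ∩ T) := by
  rw [← Set.sInter_pair]
  exact isPi2RuleSystem_sInter (by rintro _ (rfl | rfl) <;> assumption)

theorem subset_ruleClosure (B : Set (Pi2Rule ℒ V)) : B ⊆ ruleClosure B :=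
  fun _ hr _ hS => hS.2 hr

theorem ruleClosure_subset {B S : Set (Pi2Rule ℒ V)} (hS : IsPi2RuleSystem S) (h : B ⊆ S) :
    ruleClosure B ⊆ S :=
  fun _ hr => hr S ⟨hS, h⟩

end Rules

/-! ### General algebra -/

section Algebra

variable {ℒ : FirstOrder.Language.{u, 0}}

/-- `f : A → B` is a `∀`-embedding: an embedding such that `A ⊨ ∀x̄ φ(x̄, ā)` implies
`B ⊨ ∀x̄ φ(x̄, f(ā))` for every atomic formula `φ` and every tuple `ā` in `A`. -/
def IsForallEmbedding {A B : Type u} [ℒ.Structure A] [ℒ.Structure B] (f : A ↪[ℒ] B) : Prop :=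
  ∀ (m n : ℕ) (φ : ℒ.Formula (Fin m ⊕ Fin n)), φ.IsAtomic → ∀ a : Fin n → A,
    (∀ x : Fin m → A, φ.Realize (Sum.elim x a)) →
      ∀ x : Fin m → B, φ.Realize (Sum.elim x (f ∘ a))

/-- The direct product of a family of structures. -/
instance piStructure {I : Type u} (M : I → Type u) [∀ i, ℒ.Structure (M i)] :
    ℒ.Structure (∀ i, M i) where
  funMap f x i := FirstOrder.Language.Structure.funMap f fun j => x j i
  RelMap R x := ∀ i, FirstOrder.Language.Structure.RelMap R fun j => x j i

end Algebra

/-! ### The languages of intuitionistic logic and of modal logic -/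

/-- The connectives `0, 1, ∧, ∨, →` of intuitionistic logic. -/
inductive IntConn : ℕ → Type u
  | bot : IntConn 0
  | top : IntConn 0
  | and : IntConn 2
  | or : IntConn 2
  | imp : IntConn 2

/-- The connectives `0, 1, ¬, ∧, ∨` and the modalities `◇ᵢ`, for `i : ι`, of modal logic. -/
inductive ModConn (ι : Type u) : ℕ → Type u
  | bot : ModConn ι 0
  | top : ModConn ι 0
  | neg : ModConn ι 1
  | dia (i : ι) : ModConn ι 1
  | and : ModConn ι 2
  | or : ModConn ι 2

/-- The language of intuitionistic logic and of Heyting algebras. -/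
def intLang : FirstOrder.Language.{u, 0} := ⟨IntConn, fun _ => Empty⟩

/-- The language of modal logic and of modal algebras. -/
def modLang (ι : Type u) : FirstOrder.Language.{u, 0} := ⟨ModConn ι, fun _ => Empty⟩

namespace IntL

variable {V : Type u}

def bot : intLang.Term V := .func (l := 0) IntConn.bot ![]
def top : intLang.Term V := .func (l := 0) IntConn.top ![]
def and (a b : intLang.Term V) : intLang.Term V := .func (l := 2) IntConn.and ![a, b]
def or (a b : intLang.Term V) : intLang.Term V := .func (l := 2) IntConn.or ![a, b]
def imp (a b : intLang.Term V) : intLang.Term V := .func (l := 2) IntConn.imp ![a, b]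

/-- The axioms of a Hilbert calculus of the intuitionistic propositional calculus. -/
inductive IPCAxiom : intLang.Term V → Prop
  | verum : IPCAxiom top
  | weaken (a b) : IPCAxiom (imp a (imp b a))
  | distrib (a b c) : IPCAxiom (imp (imp a (imp b c)) (imp (imp a b) (imp a c)))
  | and_left (a b) : IPCAxiom (imp (and a b) a)
  | and_right (a b) : IPCAxiom (imp (and a b) b)
  | and_intro (a b) : IPCAxiom (imp a (imp b (and a b)))
  | or_left (a b) : IPCAxiom (imp a (or a b))
  | or_right (a b) : IPCAxiom (imp b (or a b))
  | or_elim (a b c) : IPCAxiom (imp (imp a c) (imp (imp b c) (imp (or a b) c)))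
  | falsum (a) : IPCAxiom (imp bot a)

/-- `L` is a (super)intuitionistic logic: a set of formulas that contains the intuitionistic
propositional calculus and is closed under modus ponens and substitution. -/
structure IsLogic (L : Set (intLang.Term V)) : Prop where
  ipc : ∀ a, IPCAxiom a → a ∈ L
  mp : ∀ a b, imp a b ∈ L → a ∈ L → b ∈ L
  subst : ∀ a ∈ L, ∀ σ : V → intLang.Term V, a.subst σ ∈ L

/-- The logic `L` as a collection of `Π₁`-rules: its theorems, as axioms, and modus ponens. -/
inductive Rules (L : Set (intLang.Term V)) : Pi2Rule intLang V → Prop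
  | thm (a) (ha : a ∈ L) : Rules L (pi1Rule ∅ Set.finite_empty a)
  | mp (a b) : Rules L (pi1Rule {a, imp a b} (Set.toFinite _) b)

/-- `A` is a Heyting algebra, the connectives being interpreted by its operations. -/
def IsAlgebra (A : Type u) [intLang.Structure A] : Prop :=
  ∃ _ : HeytingAlgebra A,
    FirstOrder.Language.Structure.funMap (L := intLang) (n := 0) IntConn.bot ![] = (⊥ : A) ∧
    FirstOrder.Language.Structure.funMap (L := intLang) (n := 0) IntConn.top ![] = (⊤ : A) ∧
    (∀ x y : A, FirstOrder.Language.Structure.funMap (L := intLang) (n := 2) IntConn.and ![x, y] = x ⊓ y) ∧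
    (∀ x y : A, FirstOrder.Language.Structure.funMap (L := intLang) (n := 2) IntConn.or ![x, y] = x ⊔ y) ∧
    (∀ x y : A, FirstOrder.Language.Structure.funMap (L := intLang) (n := 2) IntConn.imp ![x, y] = x ⇨ y)

end IntL

namespace ModL

variable {ι V : Type u}

def bot : (modLang ι).Term V := .func (l := 0) ModConn.bot ![]
def top : (modLang ι).Term V := .func (l := 0) ModConn.top ![]
def neg (a : (modLang ι).Term V) : (modLang ι).Term V := .func (l := 1) ModConn.neg ![a]
def dia (i : ι) (a : (modLang ι).Term V) : (modLang ι).Term V :=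
  .func (l := 1) (ModConn.dia i) ![a]
def and (a b : (modLang ι).Term V) : (modLang ι).Term V := .func (l := 2) ModConn.and ![a, b]
def or (a b : (modLang ι).Term V) : (modLang ι).Term V := .func (l := 2) ModConn.or ![a, b]
def imp (a b : (modLang ι).Term V) : (modLang ι).Term V := or (neg a) b
def iff (a b : (modLang ι).Term V) : (modLang ι).Term V := and (imp a b) (imp b a)
def box (i : ι) (a : (modLang ι).Term V) : (modLang ι).Term V := neg (dia i (neg a))

/-- `a` is an instance of a classical tautology: it is true under every assignment of truth values
to formulas that respects the Boolean connectives. -/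
def IsTautology (a : (modLang ι).Term V) : Prop :=
  ∀ w : (modLang ι).Term V → Prop,
    (w bot ↔ False) → (w top ↔ True) → (∀ b, w (neg b) ↔ ¬ w b) →
    (∀ b c, w (and b c) ↔ w b ∧ w c) → (∀ b c, w (or b c) ↔ w b ∨ w c) → w a

/-- `L` is a normal modal logic: a set of formulas that contains the tautologies, the axioms
`□(a → b) → (□a → □b)` and `◇a ↔ ¬□¬a`, and is closed under modus ponens, substitution and
necessitation. -/
structure IsLogic (L : Set ((modLang ι).Term V)) : Prop where
  taut : ∀ a, IsTautology a → a ∈ L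
  normal : ∀ i a b, imp (box i (imp a b)) (imp (box i a) (box i b)) ∈ L
  dual : ∀ i a, iff (dia i a) (neg (box i (neg a))) ∈ L
  mp : ∀ a b, imp a b ∈ L → a ∈ L → b ∈ L
  nec : ∀ i, ∀ a ∈ L, box i a ∈ L
  subst : ∀ a ∈ L, ∀ σ : V → (modLang ι).Term V, a.subst σ ∈ L

/-- The logic `L` as a collection of `Π₁`-rules: its theorems, as axioms, modus ponens and
necessitation. -/
inductive Rules (L : Set ((modLang ι).Term V)) : Pi2Rule (modLang ι) V → Prop
  | thm (a) (ha : a ∈ L) : Rules L (pi1Rule ∅ Set.finite_empty a)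
  | mp (a b) : Rules L (pi1Rule {a, imp a b} (Set.toFinite _) b)
  | nec (i a) : Rules L (pi1Rule {a} (Set.toFinite _) (box i a))

/-- The operation `◇ᵢ` of a structure for the language of modal logic. -/
def diaMap {A : Type u} [(modLang ι).Structure A] (i : ι) (x : A) : A :=
  FirstOrder.Language.Structure.funMap (L := modLang ι) (n := 1) (ModConn.dia i) ![x]

/-- `A` is a modal algebra: a Boolean algebra, the Boolean connectives being interpreted by its
operations, with operations `◇ᵢ` such that `◇ᵢ 0 = 0` and `◇ᵢ(x ∨ y) = ◇ᵢx ∨ ◇ᵢy`. -/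
def IsAlgebra (A : Type u) [(modLang ι).Structure A] : Prop :=
  ∃ _ : BooleanAlgebra A,
    FirstOrder.Language.Structure.funMap (L := modLang ι) (n := 0) ModConn.bot ![] = (⊥ : A) ∧
    FirstOrder.Language.Structure.funMap (L := modLang ι) (n := 0) ModConn.top ![] = (⊤ : A) ∧
    (∀ x : A, FirstOrder.Language.Structure.funMap (L := modLang ι) (n := 1) ModConn.neg ![x] = xᶜ) ∧
    (∀ x y : A, FirstOrder.Language.Structure.funMap (L := modLang ι) (n := 2) ModConn.and ![x, y] = x ⊓ y) ∧
    (∀ x y : A, FirstOrder.Language.Structure.funMap (L := modLang ι) (n := 2) ModConn.or ![x, y] = x ⊔ y) ∧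
    (∀ i : ι, diaMap i (⊥ : A) = ⊥) ∧
    (∀ (i : ι) (x y : A), diaMap i (x ⊔ y) = diaMap i x ⊔ diaMap i y)

end ModL

/-- The two kinds of logical systems: intuitionistic logics, and normal modal logics with
modalities indexed by `ι`. -/
inductive Kind : Type (u + 1)
  | intuitionistic : Kind
  | modal (ι : Type u) : Kind

namespace Kind

/-- The language of the logical system. -/
def lang : Kind.{u} → FirstOrder.Language.{u, 0}
  | intuitionistic => intLang
  | modal ι => modLang ι

/-- The constant `1`. -/
def one : (k : Kind.{u}) → k.lang.Constants
  | intuitionistic => IntConn.top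
  | modal _ => ModConn.top

/-- The (super)intuitionistic logics, respectively the normal modal logics. -/
def IsLogic {V : Type u} : (k : Kind.{u}) → Set (k.lang.Term V) → Prop
  | intuitionistic => IntL.IsLogic
  | modal _ => ModL.IsLogic

/-- A logic as a collection of `Π₁`-rules. -/
def rules {V : Type u} : (k : Kind.{u}) → Set (k.lang.Term V) → Set (Pi2Rule k.lang V)
  | intuitionistic => fun L => {r | IntL.Rules L r}
  | modal _ => fun L => {r | ModL.Rules L r}

/-- Heyting algebras, respectively modal algebras. -/
def IsAlgebra : (k : Kind.{u}) → (A : Type u) → k.lang.Structure A → Prop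
  | intuitionistic => fun A s => @IntL.IsAlgebra A s
  | modal ι => fun A s => @ModL.IsAlgebra ι A s

end Kind

/-! ### Validity, the algebras of a logic, and the two lattices -/

section Main

variable {k : Kind.{u}} {V : Type u}

/-- The formula `φ` takes the value `1` in `A` under the valuation `v`. -/
def TrueAt {A : Type u} [k.lang.Structure A] (v : V → A) (φ : k.lang.Term V) : Prop :=
  φ.realize v = (k.one : A)

/-- `A ⊨ Γ/²ψ`: for each valuation `v`, if every valuation `v'` that agrees with `v` outside the
bound variables makes all premises true, then `v` makes the conclusion true. -/
def Validates (A : Type u) [k.lang.Structure A] (r : Pi2Rule k.lang V) : Prop :=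
  ∀ v : V → A, (∀ φ ∈ r.prem, ∀ v' : V → A, (∀ p ∉ r.bound, v' p = v p) → TrueAt v' φ) →
    TrueAt v r.concl

/-- The algebras of the logic `L`: the Heyting (or modal) algebras in which every formula of `L`
takes the value `1` under every valuation. -/
structure LAlgebra (L : Set (k.lang.Term V)) : Type (u + 1) where
  carrier : Type u
  [str : k.lang.Structure carrier]
  isAlgebra : k.IsAlgebra carrier str
  models : ∀ φ ∈ L, ∀ v : V → carrier, TrueAt v φ

attribute [instance] LAlgebra.str

variable {L : Set (k.lang.Term V)}

/-- A class of `L`-algebras is an inductive rule class if it is closed under isomorphic copies of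
`∀`-subalgebras, of direct products (of arbitrary, possibly empty, families) and of
ultraproducts. -/
structure IsInductiveRuleClass (K : Set (LAlgebra L)) : Prop where
  forall_sub : ∀ (A B : LAlgebra L) (f : A.carrier ↪[k.lang] B.carrier),
    IsForallEmbedding f → B ∈ K → A ∈ K
  prod : ∀ (I : Type u) (B : I → LAlgebra L) (A : LAlgebra L), (∀ i, B i ∈ K) →
    Nonempty (A.carrier ≃[k.lang] (∀ i, (B i).carrier)) → A ∈ K
  ultraprod : ∀ (I : Type u) (U : Ultrafilter I) (B : I → LAlgebra L) (A : LAlgebra L),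
    (∀ i, B i ∈ K) →
    Nonempty (A.carrier ≃[k.lang] (U : Filter I).Product fun i => (B i).carrier) → A ∈ K

/-- The smallest inductive rule class that contains the class `K`. -/
def inductiveClosure (K : Set (LAlgebra L)) : Set (LAlgebra L) :=
  ⋂₀ {C | IsInductiveRuleClass C ∧ K ⊆ C}

theorem isInductiveRuleClass_sInter {𝒞 : Set (Set (LAlgebra L))}
    (h : ∀ C ∈ 𝒞, IsInductiveRuleClass C) : IsInductiveRuleClass (⋂₀ 𝒞) where
  forall_sub A B f hf hB C hC := (h C hC).forall_sub A B f hf (hB C hC)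
  prod I B A hB hA C hC := (h C hC).prod I B A (fun i => hB i C hC) hA
  ultraprod I U B A hB hA C hC := (h C hC).ultraprod I U B A (fun i => hB i C hC) hA

theorem isInductiveRuleClass_inductiveClosure (K : Set (LAlgebra L)) :
    IsInductiveRuleClass (inductiveClosure K) :=
  isInductiveRuleClass_sInter fun _ hC => hC.1

theorem isInductiveRuleClass_inter {C D : Set (LAlgebra L)} (hC : IsInductiveRuleClass C)
    (hD : IsInductiveRuleClass D) : IsInductiveRuleClass (C ∩ D) := by
  rw [← Set.sInter_pair]
  exact isInductiveRuleClass_sInter (by rintro _ (rfl | rfl) <;> assumption)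

theorem subset_inductiveClosure (K : Set (LAlgebra L)) : K ⊆ inductiveClosure K :=
  fun _ hA _ hC => hC.2 hA

theorem inductiveClosure_subset {K C : Set (LAlgebra L)} (hC : IsInductiveRuleClass C)
    (h : K ⊆ C) : inductiveClosure K ⊆ C :=
  fun _ hA => hA C ⟨hC, h⟩

/-- The `Π₂`-rules valid in all algebras of the class `K`. -/
def pi2 (K : Set (LAlgebra L)) : Set (Pi2Rule k.lang V) :=
  {r | ∀ A ∈ K, Validates A.carrier r}

/-- The class of all `L`-algebras that validate all rules of `S`. -/
def ind (L : Set (k.lang.Term V)) (S : Set (Pi2Rule k.lang V)) : Set (LAlgebra L) :=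
  {A | ∀ r ∈ S, Validates A.carrier r}

/-- The `Π₂`-rule systems that extend the logic `L`, ordered by inclusion. -/
def RuleSystem (L : Set (k.lang.Term V)) : Type u :=
  {S : Set (Pi2Rule k.lang V) // IsPi2RuleSystem S ∧ k.rules L ⊆ S}

/-- The inductive rule classes of `L`-algebras, ordered by inclusion. -/
def InductiveRuleClass (L : Set (k.lang.Term V)) : Type (u + 1) :=
  {K : Set (LAlgebra L) // IsInductiveRuleClass K}

/-- The lattice of `Π₂`-rule systems extending `L`: the meet is the intersection, the join of `S`
and `T` is the smallest `Π₂`-rule system that contains `S ∪ T`. -/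
instance : Lattice (RuleSystem L) where
  le S T := S.1 ⊆ T.1
  le_refl _ := subset_rfl
  le_trans _ _ _ h₁ h₂ := h₁.trans h₂
  le_antisymm _ _ h₁ h₂ := Subtype.ext (h₁.antisymm h₂)
  inf S T := ⟨S.1 ∩ T.1, isPi2RuleSystem_inter S.2.1 T.2.1, Set.subset_inter S.2.2 T.2.2⟩
  inf_le_left _ _ := Set.inter_subset_left
  inf_le_right _ _ := Set.inter_subset_right
  le_inf _ _ _ h₁ h₂ := Set.subset_inter h₁ h₂
  sup S T := ⟨ruleClosure (S.1 ∪ T.1), isPi2RuleSystem_ruleClosure _,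
    S.2.2.trans (Set.subset_union_left.trans (subset_ruleClosure _))⟩
  le_sup_left _ _ := Set.subset_union_left.trans (subset_ruleClosure _)
  le_sup_right _ _ := Set.subset_union_right.trans (subset_ruleClosure _)
  sup_le _ _ U h₁ h₂ := ruleClosure_subset U.2.1 (Set.union_subset h₁ h₂)

/-- The lattice of inductive rule classes of `L`-algebras: the meet is the intersection, the join
of `K` and `M` is the smallest inductive rule class that contains `K ∪ M`. -/
instance : Lattice (InductiveRuleClass L) where
  le K M := K.1 ⊆ M.1
  le_refl _ := subset_rfl
  le_trans _ _ _ h₁ h₂ := h₁.trans h₂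
  le_antisymm _ _ h₁ h₂ := Subtype.ext (h₁.antisymm h₂)
  inf K M := ⟨K.1 ∩ M.1, isInductiveRuleClass_inter K.2 M.2⟩
  inf_le_left _ _ := Set.inter_subset_left
  inf_le_right _ _ := Set.inter_subset_right
  le_inf _ _ _ h₁ h₂ := Set.subset_inter h₁ h₂
  sup K M := ⟨inductiveClosure (K.1 ∪ M.1), isInductiveRuleClass_inductiveClosure _⟩
  le_sup_left _ _ := Set.subset_union_left.trans (subset_inductiveClosure _)
  le_sup_right _ _ := Set.subset_union_right.trans (subset_inductiveClosure _)
  sup_le _ _ U h₁ h₂ := inductiveClosure_subset U.2 (Set.union_subset h₁ h₂)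

end Main

end PiTwo

/-!
`S ↦ Ind(S)` and `K ↦ Π₂(K)` form a Galois connection, so all that is needed is that both closed
elements are as expected.

*Completeness*, `Π₂(Ind(S)) = S`. For a rule `r = ∀p̄ Γ/ψ` let `T` be the set of all `φ` such that
`S` contains `∀p̄ Γ/σ₀(φ)`, where `σ₀` replaces every bound variable of `r` by the constant `1`.
`T` is a theory of `L`, and the Lindenbaum algebra of formulas modulo `T` validates `S`: a rule in
`S` whose premises hold there has an instance, with bound variables renamed apart, to which rule
cut applies. If `r ∉ S`, then the premises of `r` hold in this algebra under the identity
valuation, and its conclusion does not.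

*Definability*, `Ind(Π₂(K)) = K`. Let `A` validate `Π₂(K)`. A finite set of universal equations
with parameters that hold in `A`, together with one `a ≠ 1`, makes up a `Π₂`-rule which fails in
`A`, hence in some member of `K`. The product over all `a ≠ 1` of these members satisfies the
equations and sends only `1` to `1`. An ultraproduct over all finite sets of equations then
satisfies all of them, so that `A` is a `∀`-subalgebra of it.
-/

namespace PiTwo

open FirstOrder.Language

section Terms

variable {ℒ : FirstOrder.Language.{u, 0}} {V W : Type u}

theorem vars_var (p : V) : vars (.var p : ℒ.Term V) = {p} := by
  simp [vars, Term.varFinset]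

theorem vars_func {n : ℕ} (f : ℒ.Functions n) (ts : Fin n → ℒ.Term V) :
    vars (.func f ts) = ⋃ i, vars (ts i) := by
  simp [vars, Term.varFinset]

theorem finite_vars (φ : ℒ.Term V) : (vars φ).Finite :=
  Finset.finite_toSet _

theorem finite_varsOf {Γ : Set (ℒ.Term V)} (hΓ : Γ.Finite) : (varsOf Γ).Finite :=
  hΓ.biUnion fun φ _ => finite_vars φ

theorem vars_subset_varsOf {Γ : Set (ℒ.Term V)} {φ : ℒ.Term V} (h : φ ∈ Γ) :
    vars φ ⊆ varsOf Γ :=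
  Set.subset_biUnion_of_mem (u := vars) h

theorem realize_congr {A : Type*} [ℒ.Structure A] {φ : ℒ.Term V} {v w : V → A}
    (h : Set.EqOn v w (vars φ)) : φ.realize v = φ.realize w := by
  induction φ with
  | var p => exact h (by simp [vars_var])
  | func f ts ih =>
    simp only [Term.realize]
    exact congrArg _ (funext fun i =>
      ih i (h.mono (vars_func f ts ▸ Set.subset_iUnion (fun i => vars (ts i)) i)))

/-- The absolutely free algebra of terms, as a structure. For the algebraic languages at hand the
interpretation of relation symbols is immaterial. -/
instance termStructure : ℒ.Structure (ℒ.Term V) where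
  funMap := .func
  RelMap _ _ := False

theorem realize_eq_subst (φ : ℒ.Term V) (σ : V → ℒ.Term W) : φ.realize σ = φ.subst σ := by
  induction φ with
  | var p => rfl
  | func f ts ih => simp only [Term.realize, Term.subst, ih]; rfl

theorem subst_congr {φ : ℒ.Term V} {σ τ : V → ℒ.Term W} (h : Set.EqOn σ τ (vars φ)) :
    φ.subst σ = φ.subst τ := by
  simpa only [realize_eq_subst] using realize_congr h

theorem subst_var (φ : ℒ.Term V) : φ.subst .var = φ := by
  induction φ with
  | var p => rfl
  | func f ts ih => simp only [Term.subst, ih]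

theorem subst_subst {X : Type u} (φ : ℒ.Term V) (σ : V → ℒ.Term W) (τ : W → ℒ.Term X) :
    (φ.subst σ).subst τ = φ.subst fun p => (σ p).subst τ := by
  simpa only [realize_eq_subst] using Term.realize_subst (t := φ) (tf := σ) (v := τ)

theorem vars_subst (φ : ℒ.Term V) (σ : V → ℒ.Term W) :
    vars (φ.subst σ) = ⋃ p ∈ vars φ, vars (σ p) := by
  induction φ with
  | var p => simp [vars_var, Term.subst]
  | func f ts ih => simp only [Term.subst, vars_func, ih, Set.biUnion_iUnion]

theorem mem_vars_subst {φ : ℒ.Term V} {σ : V → ℒ.Term W} {q : W} :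
    q ∈ vars (φ.subst σ) ↔ ∃ p ∈ vars φ, q ∈ vars (σ p) := by
  simp [vars_subst]

end Terms

section Renaming

variable {α β : Type*}

theorem exists_injOn_fin {F : Set α} (hF : F.Finite) :
    ∃ (n : ℕ) (g : α → Fin n), Set.InjOn g F := by
  have : F.encard ≤ (Set.univ : Set (Fin (F.ncard + 1))).encard := by
    rw [Set.encard_univ, ENat.card_eq_coe_fintype_card, Fintype.card_fin, ← hF.cast_ncard_eq]
    exact_mod_cast Nat.le_succ _
  obtain ⟨g, -, hg⟩ := hF.exists_injOn_of_encard_le this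
  exact ⟨_, g, hg⟩

theorem exists_injOn_mapsTo_compl [Infinite β] {F : Set α} (hF : F.Finite) {X : Set β}
    (hX : X.Finite) : ∃ g : α → β, Set.InjOn g F ∧ Set.MapsTo g F Xᶜ := by
  have : F.encard ≤ Xᶜ.encard := by simp [hX.infinite_compl.encard_eq]
  obtain ⟨g, hgX, hg⟩ := hF.exists_injOn_of_encard_le this
  exact ⟨g, hg, hgX⟩

theorem exists_eqOn_comp {A : Type*} [Nonempty A] {g : α → β} {F : Set α} (hg : Set.InjOn g F)
    (x : α → A) : ∃ y : β → A, Set.EqOn (y ∘ g) x F :=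
  ⟨Function.extend (F.domRestrict g) (F.domRestrict x) fun _ => Classical.arbitrary A,
    fun a ha => hg.injective.extend_apply _ _ ⟨a, ha⟩⟩

end Renaming

section Soundness

variable {k : Kind.{u}} {V : Type u} {A : Type u} [k.lang.Structure A]

theorem trueAt_congr {φ : k.lang.Term V} {v w : V → A} (h : Set.EqOn v w (vars φ)) :
    TrueAt v φ ↔ TrueAt w φ := by
  rw [TrueAt, TrueAt, realize_congr h]

theorem trueAt_subst {W : Type u} {φ : k.lang.Term V} {σ : V → k.lang.Term W} {v : W → A} :
    TrueAt v (φ.subst σ) ↔ TrueAt (fun p => (σ p).realize v) φ := by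
  rw [TrueAt, TrueAt, Term.realize_subst]

theorem validates_of_concl_eq_subst {r : Pi2Rule k.lang V} {χ : k.lang.Term V}
    {σ : V → k.lang.Term V} (hχ : χ ∈ r.prem) (hσ : ∀ p ∉ r.bound, σ p = .var p)
    (hr : r.concl = χ.subst σ) : Validates A r := by
  intro v hv
  rw [hr, trueAt_subst]
  exact hv χ hχ _ fun p hp => by rw [hσ p hp, Term.realize_var]

theorem Validates.mono {r₀ r : Pi2Rule k.lang V} (h : Validates A r₀) (hprem : r₀.prem ⊆ r.prem)
    (hbound : r.bound = r₀.bound) (hconcl : r.concl = r₀.concl) : Validates A r := by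
  intro v hv
  rw [hconcl]
  exact h v fun φ hφ v' hv' => hv φ (hprem hφ) v' (hbound ▸ hv')

theorem Validates.rename_bound {r₀ r : Pi2Rule k.lang V} {ρ : V → V} (h : Validates A r₀)
    (hρ : Set.InjOn ρ r₀.bound) (hfix : ∀ p ∉ r₀.bound, ρ p = p)
    (hfree : Disjoint (ρ '' r₀.bound) (varsOf r₀.prem \ r₀.bound))
    (hprem : r.prem = substSet (fun p => .var (ρ p)) r₀.prem)
    (hbound : r.bound = ρ '' r₀.bound) (hconcl : r.concl = r₀.concl) : Validates A r := by
  classical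
  intro v hv
  rw [hconcl]
  refine h v fun φ hφ v' hv' => ?_
  have : Nonempty A := ⟨(k.one : A)⟩
  obtain ⟨y, hy⟩ := exists_eqOn_comp hρ v'
  have hw : TrueAt ((ρ '' r₀.bound).piecewise y v) (φ.subst fun p => .var (ρ p)) :=
    hv _ (hprem ▸ ⟨φ, hφ, rfl⟩) _ (hbound ▸ Set.piecewise_eqOn_compl _ y v)
  refine (trueAt_congr fun p hp => ?_).1 (trueAt_subst.1 hw)
  by_cases hpb : p ∈ r₀.bound
  · simpa [Set.mem_image_of_mem ρ hpb] using hy hpb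
  · have : p ∉ ρ '' r₀.bound := fun hp' =>
      Set.disjoint_left.1 hfree hp' ⟨vars_subset_varsOf hφ hp, hpb⟩
    simp [hfix p hpb, this, hv' p hpb]

theorem Validates.cut {d r : Pi2Rule k.lang V} (h : Validates A d)
    (hd : ∀ μ ∈ d.prem, ∃ g, Validates A g ∧ g.prem = r.prem ∧ g.bound = r.bound ∧ g.concl = μ)
    (hfresh : Disjoint d.bound (varsOf r.prem)) (hconcl : r.concl = d.concl) :
    Validates A r := by
  classical
  intro v hv
  rw [hconcl]
  refine h v fun μ hμ v' hv' => ?_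
  obtain ⟨g, hg, hgprem, hgbound, rfl⟩ := hd μ hμ
  refine hg v' fun φ hφ w hw => ?_
  rw [hgprem] at hφ
  rw [hgbound] at hw
  have hw' : TrueAt (d.bound.piecewise v w) φ := hv φ hφ _ fun p hp => by
    by_cases hpd : p ∈ d.bound
    · simp [hpd]
    · simp [hpd, hw p hp, hv' p hpd]
  have hφd : vars φ ⊆ d.boundᶜ := (vars_subset_varsOf hφ).trans hfresh.subset_compl_left
  exact (trueAt_congr ((Set.piecewise_eqOn_compl _ v w).mono hφd)).1 hw'

theorem Validates.subst {r₀ r : Pi2Rule k.lang V} {σ : V → k.lang.Term V} (h : Validates A r₀)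
    (hfix : ∀ p ∈ r₀.bound, σ p = .var p)
    (hfresh : ∀ q ∈ varsOf r₀.prem \ r₀.bound, Disjoint r₀.bound (vars (σ q)))
    (hprem : r.prem = substSet σ r₀.prem) (hbound : r.bound = r₀.bound)
    (hconcl : r.concl = r₀.concl.subst σ) : Validates A r := by
  classical
  intro v hv
  rw [hconcl, trueAt_subst]
  refine h _ fun φ hφ v' hv' => ?_
  have hw : TrueAt (r₀.bound.piecewise v' v) (φ.subst σ) :=
    hv _ (hprem ▸ ⟨φ, hφ, rfl⟩) _ (hbound ▸ Set.piecewise_eqOn_compl _ v' v)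
  refine (trueAt_congr fun p hp => ?_).1 (trueAt_subst.1 hw)
  by_cases hpb : p ∈ r₀.bound
  · simp [hfix p hpb, hpb]
  · rw [hv' p hpb]
    exact realize_congr ((Set.piecewise_eqOn_compl _ v' v).mono
      (hfresh p ⟨vars_subset_varsOf hφ hp, hpb⟩).subset_compl_left)

theorem isPi2RuleSystem_validates (A : Type u) [k.lang.Structure A] :
    IsPi2RuleSystem {r : Pi2Rule k.lang V | Validates A r} where
  strong_reflexivity _ _ _ hχ hσ _ hr := validates_of_concl_eq_subst hχ hσ hr
  monotonicity _ _ h := Validates.mono h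
  alpha_renaming _ _ _ h hρ hfix hfree _ := Validates.rename_bound h hρ hfix hfree
  rule_cut _ _ h := Validates.cut h
  bound_structurality _ _ _ h hfix hfresh :=
    Validates.subst h hfix fun q hq => hfresh q ⟨.inl (.inl hq.1), hq.2⟩

theorem isPi2RuleSystem_pi2 {L : Set (k.lang.Term V)} (K : Set (LAlgebra L)) :
    IsPi2RuleSystem (pi2 K) := by
  have : pi2 K = ⋂₀ ((fun A : LAlgebra L => {r | Validates A.carrier r}) '' K) := by
    ext r
    simp [pi2]
  rw [this]
  exact isPi2RuleSystem_sInter (Set.forall_mem_image.2 fun A _ =>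
    isPi2RuleSystem_validates A.carrier)

end Soundness

section ForallEmbedding

variable {ℒ : FirstOrder.Language.{u, 0}} {A B : Type u} [ℒ.Structure A] [ℒ.Structure B]
  {f : A ↪[ℒ] B}

theorem isForallEmbedding_iff [ℒ.IsAlgebraic] :
    IsForallEmbedding f ↔ ∀ (m n : ℕ) (s t : ℒ.Term (Fin m ⊕ Fin n)) (a : Fin n → A),
      (∀ x : Fin m → A, s.realize (Sum.elim x a) = t.realize (Sum.elim x a)) →
        ∀ x : Fin m → B, s.realize (Sum.elim x (f ∘ a)) = t.realize (Sum.elim x (f ∘ a)) := by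
  refine ⟨fun hf m n s t a => ?_, fun hf m n φ hφ a => ?_⟩
  · simpa only [Formula.realize_equal] using hf m n (s.equal t) (.equal _ _) a
  · cases hφ with
    | equal s t =>
      -- No bound variable is in scope in an atomic formula, so the terms live over `Fin m ⊕ Fin n`.
      let c : (Fin m ⊕ Fin n) ⊕ Fin 0 → Fin m ⊕ Fin n := Sum.elim id Fin.elim0
      have hc {C : Type u} [ℒ.Structure C] (r : ℒ.Term _) (y : Fin m ⊕ Fin n → C) :
          r.realize (Sum.elim y default) = (r.relabel c).realize y := by
        rw [Term.realize_relabel]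
        exact congrArg r.realize (funext (by rintro (_ | i); exacts [rfl, i.elim0]))
      simpa only [Formula.Realize, BoundedFormula.realize_bdEqual, hc] using
        hf m n (s.relabel c) (t.relabel c) a
    | rel R => exact isEmptyElim R

theorem IsForallEmbedding.realize_eq [Nonempty A] (hf : IsForallEmbedding f) {α β : Type u}
    {s t : ℒ.Term (α ⊕ β)} {a : β → A}
    (h : ∀ x : α → A, s.realize (Sum.elim x a) = t.realize (Sum.elim x a)) (x : α → B) :
    s.realize (Sum.elim x (f ∘ a)) = t.realize (Sum.elim x (f ∘ a)) := by
  have : Nonempty B := .map f inferInstance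
  have hF := (finite_vars s).union (finite_vars t)
  obtain ⟨m, g, hg⟩ := exists_injOn_fin (hF.preimage Sum.inl_injective.injOn)
  obtain ⟨n, g', hg'⟩ := exists_injOn_fin (hF.preimage Sum.inr_injective.injOn)
  obtain ⟨x', hx'⟩ := exists_eqOn_comp hg x
  obtain ⟨a', ha'⟩ := exists_eqOn_comp hg' a
  have realize_relabel {C : Type u} [ℒ.Structure C] {y : Fin m → C} {b' : Fin n → C} {b : β → C}
      (hb : Set.EqOn (b' ∘ g') b (Sum.inr ⁻¹' (vars s ∪ vars t))) {r : ℒ.Term (α ⊕ β)}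
      (hr : vars r ⊆ vars s ∪ vars t) :
      (r.relabel (Sum.map g g')).realize (Sum.elim y b') = r.realize (Sum.elim (y ∘ g) b) := by
    rw [Term.realize_relabel, Sum.elim_comp_map]
    refine realize_congr ?_
    rintro (p | p) hp
    exacts [rfl, hb (hr hp)]
  have key := (Formula.realize_equal (t₁ := s.relabel (Sum.map g g'))).1 <|
    hf m n (s.relabel (Sum.map g g') |>.equal (t.relabel (Sum.map g g'))) (.equal _ _) a'
      (fun y => by
        rw [Formula.realize_equal, realize_relabel ha' Set.subset_union_left,
          realize_relabel ha' Set.subset_union_right, h]) x'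
  have hfa : Set.EqOn ((f ∘ a') ∘ g') (f ∘ a) (Sum.inr ⁻¹' (vars s ∪ vars t)) :=
    fun p hp => congrArg f (ha' hp)
  rw [realize_relabel hfa Set.subset_union_left, realize_relabel hfa Set.subset_union_right] at key
  have hx : Set.EqOn (Sum.elim (x' ∘ g) (f ∘ a)) (Sum.elim x (f ∘ a)) (vars s ∪ vars t) := by
    rintro (p | p) hp
    exacts [hx' hp, rfl]
  rwa [realize_congr (hx.mono Set.subset_union_left),
    realize_congr (hx.mono Set.subset_union_right)] at key

end ForallEmbedding

instance Kind.lang_isAlgebraic (k : Kind.{u}) : k.lang.IsAlgebraic := fun n => by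
  cases k <;> exact inferInstanceAs (IsEmpty Empty)

section Preservation

variable {k : Kind.{u}} {V : Type u}

theorem realize_one {α A : Type*} [k.lang.Structure A] (v : α → A) :
    (k.one.term : k.lang.Term α).realize v = (k.one : A) :=
  Term.realize_constants

theorem map_one {A B F : Type*} [k.lang.Structure A] [k.lang.Structure B] [FunLike F A B]
    [k.lang.HomClass F A B] (f : F) : f (k.one : A) = (k.one : B) :=
  HomClass.map_constants f k.one

theorem Validates.of_forallEmbedding {A B : Type u} [k.lang.Structure A] [k.lang.Structure B]
    {f : A ↪[k.lang] B} (hf : IsForallEmbedding f) {r : Pi2Rule k.lang V} (hB : Validates B r) :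
    Validates A r := by
  classical
  have : Nonempty A := ⟨(k.one : A)⟩
  intro v hv
  let c : V → V ⊕ V := fun p => if p ∈ r.bound then .inl p else .inr p
  have realize_relabel {C : Type u} [k.lang.Structure C] (φ : k.lang.Term V) (x w : V → C) :
      (φ.relabel c).realize (Sum.elim x w) = φ.realize (r.bound.piecewise x w) := by
    rw [Term.realize_relabel]
    exact congrArg φ.realize (funext fun p => apply_ite (Sum.elim x w) _ _ _)
  have key := hB (f ∘ v) fun φ hφ w hw => by
    have hφA (x : V → A) : (φ.relabel c).realize (Sum.elim x v) =
        (k.one.term : k.lang.Term (V ⊕ V)).realize (Sum.elim x v) := by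
      rw [realize_relabel, realize_one]
      exact hv φ hφ _ (Set.piecewise_eqOn_compl _ x v)
    have hpw : r.bound.piecewise w (f ∘ v) = w := funext fun p => by
      by_cases hp : p ∈ r.bound <;> simp [hp, hw]
    simpa only [TrueAt, realize_relabel, realize_one, hpw] using hf.realize_eq hφA w
  rw [TrueAt, HomClass.realize_term, ← map_one f] at key
  exact f.injective key

theorem Validates.of_jointly_injective {I : Type*} {A : Type u} {B : I → Type u}
    [k.lang.Structure A] [∀ i, k.lang.Structure (B i)] (π : ∀ i, A →[k.lang] B i)
    (hπ : ∀ i, Function.Surjective (π i)) (hinj : ∀ a b, (∀ i, π i a = π i b) → a = b)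
    {r : Pi2Rule k.lang V} (hB : ∀ i, Validates (B i) r) : Validates A r := by
  classical
  refine fun v hv => hinj _ _ fun i => ?_
  rw [← HomClass.realize_term, map_one]
  refine hB i _ fun φ hφ w hw => ?_
  let w' : V → A := r.bound.piecewise (Function.surjInv (hπ i) ∘ w) v
  have hw' : π i ∘ w' = w := by
    funext p
    by_cases hp : p ∈ r.bound
    · simp [w', hp, Function.surjInv_eq]
    · simp [w', hp, hw p hp]
  rw [← hw', TrueAt, HomClass.realize_term, hv φ hφ w' (Set.piecewise_eqOn_compl _ _ v), map_one]

theorem Validates.of_equiv {A B : Type u} [k.lang.Structure A] [k.lang.Structure B]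
    (e : A ≃[k.lang] B) {r : Pi2Rule k.lang V} (hB : Validates B r) : Validates A r :=
  .of_jointly_injective (fun _ : Unit => e.toHom) (fun _ => e.surjective)
    (fun _ _ h => e.injective (h ())) fun _ => hB

/-- The projection of a direct product onto a factor, as a homomorphism. -/
def projection {ℒ : FirstOrder.Language.{u, 0}} {I : Type u} (B : I → Type u)
    [∀ i, ℒ.Structure (B i)] (i : I) : (∀ i, B i) →[ℒ] B i where
  toFun a := a i
  map_fun' _ _ := rfl
  map_rel' _ _ h := h i

theorem realize_pi {ℒ : FirstOrder.Language.{u, 0}} {I : Type u} (B : I → Type u)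
    [∀ i, ℒ.Structure (B i)] {α : Type*} (t : ℒ.Term α) (v : α → ∀ i, B i) (i : I) :
    t.realize v i = t.realize fun p => v p i :=
  (HomClass.realize_term (projection B i)).symm

theorem Validates.pi {I : Type u} {B : I → Type u} [∀ i, k.lang.Structure (B i)]
    {r : Pi2Rule k.lang V} (hB : ∀ i, Validates (B i) r) : Validates (∀ i, B i) r :=
  have : ∀ i, Nonempty (B i) := fun i => ⟨(k.one : B i)⟩
  .of_jointly_injective (projection B) (fun i => Function.surjective_eval i)
    (fun _ _ => funext) hB

section Ultraproduct

variable {I : Type u} {U : Ultrafilter I} {B : I → Type u}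

/-- The element of an ultraproduct represented by an element of the direct product. -/
def ultraMk (U : Ultrafilter I) (x : ∀ i, B i) : (U : Filter I).Product B :=
  Quotient.mk _ x

theorem realize_ultraMk_eq_iff {ℒ : FirstOrder.Language.{u, 0}} [∀ i, ℒ.Structure (B i)]
    {α : Type*} (s t : ℒ.Term α) (v : α → ∀ i, B i) :
    s.realize (fun p => ultraMk U (v p)) = t.realize (fun p => ultraMk U (v p)) ↔
      ∀ᶠ i in U, s.realize (fun p => v p i) = t.realize (fun p => v p i) := by
  have h := Ultraproduct.term_realize_cast (L := ℒ) (u := U) v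
  exact (iff_of_eq (congrArg₂ (· = ·) (h s) (h t))).trans Quotient.eq''

theorem trueAt_ultraMk_iff [∀ i, k.lang.Structure (B i)] {φ : k.lang.Term V}
    {v : V → ∀ i, B i} :
    TrueAt (fun p => ultraMk U (v p)) φ ↔ ∀ᶠ i in U, TrueAt (fun p => v p i) φ := by
  simpa only [TrueAt, realize_one] using realize_ultraMk_eq_iff (U := U) φ k.one.term v

theorem exists_eq_ultraMk_comp {α : Type*} (v : α → (U : Filter I).Product B) :
    ∃ w : α → ∀ i, B i, v = fun p => ultraMk U (w p) := by
  choose w hw using fun p => Quotient.exists_rep (v p)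
  exact ⟨w, funext fun p => (hw p).symm⟩

/-- If the formula failed under a variant of the `i`-th valuation for `U`-many `i`, then these
variants would represent a valuation in the ultraproduct under which it fails. -/
theorem eventually_forall_trueAt [∀ i, k.lang.Structure (B i)] {φ : k.lang.Term V} {F : Set V}
    {v : V → ∀ i, B i} (h : ∀ w : V → (U : Filter I).Product B,
      Set.EqOn w (fun p => ultraMk U (v p)) Fᶜ → TrueAt w φ) :
    ∀ᶠ i in U, ∀ w : V → B i, Set.EqOn w (fun p => v p i) Fᶜ → TrueAt w φ := by
  by_contra hfail
  rw [← Ultrafilter.eventually_not] at hfail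
  have hvariant (i : I) : ∃ w : V → B i, Set.EqOn w (fun p => v p i) Fᶜ ∧
      (TrueAt w φ → ∀ w : V → B i, Set.EqOn w (fun p => v p i) Fᶜ → TrueAt w φ) := by
    by_contra! h
    obtain ⟨w, hw, hwφ⟩ := (h _ fun _ _ => rfl).2
    exact hwφ (h w hw).1
  choose w hw hwφ using hvariant
  have hφ : TrueAt (fun p => ultraMk U fun i => w i p) φ :=
    h _ fun p hp => congrArg _ (funext fun i => hw i hp)
  obtain ⟨i, hi, hi'⟩ := ((trueAt_ultraMk_iff.1 hφ).and hfail).exists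
  exact hi' (hwφ i hi)

theorem Validates.ultraproduct [∀ i, k.lang.Structure (B i)] {r : Pi2Rule k.lang V}
    (hB : ∀ i, Validates (B i) r) : Validates ((U : Filter I).Product B) r := by
  intro v hv
  obtain ⟨v, rfl⟩ := exists_eq_ultraMk_comp v
  have hprem : ∀ φ ∈ r.prem, ∀ᶠ i in U, ∀ w : V → B i,
      Set.EqOn w (fun p => v p i) r.boundᶜ → TrueAt w φ :=
    fun φ hφ => eventually_forall_trueAt (hv φ hφ)
  rw [trueAt_ultraMk_iff]
  filter_upwards [(Filter.eventually_all_finite r.prem_finite).2 hprem] with i hi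
  exact hB i _ hi

end Ultraproduct

theorem isInductiveRuleClass_ind (L : Set (k.lang.Term V)) (S : Set (Pi2Rule k.lang V)) :
    IsInductiveRuleClass (ind L S) where
  forall_sub _ _ _ hf hB r hr := (hB r hr).of_forallEmbedding hf
  prod _ _ _ hB := fun ⟨e⟩ r hr => (Validates.pi fun i => hB i r hr).of_equiv e
  ultraprod _ _ _ _ hB := fun ⟨e⟩ r hr => (Validates.ultraproduct fun i => hB i r hr).of_equiv e

end Preservation

/-- Operations interpreting the intuitionistic connectives. In the modal case `imp` is the derived
operation `¬a ∨ b`, so that both kinds of algebras can be treated alike. -/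
structure Connectives (A : Type*) where
  bot : A
  top : A
  and : A → A → A
  or : A → A → A
  imp : A → A → A

namespace Connectives

variable {A : Type*} (c : Connectives A)

/-- The biconditional. -/
def iff (a b : A) : A := c.and (c.imp a b) (c.imp b a)

/-- The elements of `A` that are values of axioms of the intuitionistic propositional calculus. -/
inductive IsIpcAxiom : A → Prop
  | verum : IsIpcAxiom c.top
  | weaken (a b : A) : IsIpcAxiom (c.imp a (c.imp b a))
  | distrib (a b d : A) :
      IsIpcAxiom (c.imp (c.imp a (c.imp b d)) (c.imp (c.imp a b) (c.imp a d)))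
  | and_left (a b : A) : IsIpcAxiom (c.imp (c.and a b) a)
  | and_right (a b : A) : IsIpcAxiom (c.imp (c.and a b) b)
  | and_intro (a b : A) : IsIpcAxiom (c.imp a (c.imp b (c.and a b)))
  | or_left (a b : A) : IsIpcAxiom (c.imp a (c.or a b))
  | or_right (a b : A) : IsIpcAxiom (c.imp b (c.or a b))
  | or_elim (a b d : A) :
      IsIpcAxiom (c.imp (c.imp a d) (c.imp (c.imp b d) (c.imp (c.or a b) d)))
  | falsum (a : A) : IsIpcAxiom (c.imp c.bot a)

section Hom

variable {B : Type*} {c} {d : Connectives B}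

/-- `f` is a homomorphism from the operations `c` on `A` to the operations `d` on `B`. -/
structure IsHom (c : Connectives A) (d : Connectives B) (f : A → B) : Prop where
  map_bot : f c.bot = d.bot
  map_top : f c.top = d.top
  map_and : ∀ a b, f (c.and a b) = d.and (f a) (f b)
  map_or : ∀ a b, f (c.or a b) = d.or (f a) (f b)
  map_imp : ∀ a b, f (c.imp a b) = d.imp (f a) (f b)

theorem IsHom.map_iff {f : A → B} (hf : c.IsHom d f) (a b : A) :
    f (c.iff a b) = d.iff (f a) (f b) := by
  simp only [iff, hf.map_and, hf.map_imp]

/-- Each axiom involves at most three variables, so it is enough that the homomorphisms `f v` reach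
any three elements of `B` at a time. -/
theorem IsIpcAxiom.exists_eq {J : Type*} {f : J → A → B} (hf : ∀ v, c.IsHom d (f v))
    (h : ∀ x y z : B, ∃ v, x ∈ Set.range (f v) ∧ y ∈ Set.range (f v) ∧ z ∈ Set.range (f v))
    {b : B} (hb : d.IsIpcAxiom b) : ∃ v a, c.IsIpcAxiom a ∧ f v a = b := by
  cases hb with
  | verum =>
    obtain ⟨v, -⟩ := h d.top d.top d.top
    exact ⟨v, _, .verum, (hf v).map_top⟩
  | weaken x y =>
    obtain ⟨v, ⟨x, rfl⟩, ⟨y, rfl⟩, -⟩ := h x y x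
    exact ⟨v, _, .weaken x y, by simp only [(hf v).map_imp]⟩
  | distrib x y z =>
    obtain ⟨v, ⟨x, rfl⟩, ⟨y, rfl⟩, ⟨z, rfl⟩⟩ := h x y z
    exact ⟨v, _, .distrib x y z, by simp only [(hf v).map_imp]⟩
  | and_left x y =>
    obtain ⟨v, ⟨x, rfl⟩, ⟨y, rfl⟩, -⟩ := h x y x
    exact ⟨v, _, .and_left x y, by simp only [(hf v).map_imp, (hf v).map_and]⟩
  | and_right x y =>
    obtain ⟨v, ⟨x, rfl⟩, ⟨y, rfl⟩, -⟩ := h x y x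
    exact ⟨v, _, .and_right x y, by simp only [(hf v).map_imp, (hf v).map_and]⟩
  | and_intro x y =>
    obtain ⟨v, ⟨x, rfl⟩, ⟨y, rfl⟩, -⟩ := h x y x
    exact ⟨v, _, .and_intro x y, by simp only [(hf v).map_imp, (hf v).map_and]⟩
  | or_left x y =>
    obtain ⟨v, ⟨x, rfl⟩, ⟨y, rfl⟩, -⟩ := h x y x
    exact ⟨v, _, .or_left x y, by simp only [(hf v).map_imp, (hf v).map_or]⟩
  | or_right x y =>
    obtain ⟨v, ⟨x, rfl⟩, ⟨y, rfl⟩, -⟩ := h x y x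
    exact ⟨v, _, .or_right x y, by simp only [(hf v).map_imp, (hf v).map_or]⟩
  | or_elim x y z =>
    obtain ⟨v, ⟨x, rfl⟩, ⟨y, rfl⟩, ⟨z, rfl⟩⟩ := h x y z
    exact ⟨v, _, .or_elim x y z, by simp only [(hf v).map_imp, (hf v).map_or]⟩
  | falsum x =>
    obtain ⟨v, ⟨x, rfl⟩, -⟩ := h x x x
    exact ⟨v, _, .falsum x, by simp only [(hf v).map_imp, (hf v).map_bot]⟩

end Hom

/-- A deductive filter: a set that contains the values of the axioms of the intuitionistic
propositional calculus and is closed under modus ponens. On an algebra of formulas these are the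
intuitionistic theories. -/
structure IsFilter (F : Set A) : Prop where
  ipc_mem : ∀ {a}, c.IsIpcAxiom a → a ∈ F
  mp : ∀ {a b}, c.imp a b ∈ F → a ∈ F → b ∈ F

namespace IsFilter

variable {c} {F : Set A} (hF : c.IsFilter F) {a a' b b' d : A}
include hF

theorem imp_mem_of_mem (ha : a ∈ F) : c.imp b a ∈ F :=
  hF.mp (hF.ipc_mem (.weaken a b)) ha

theorem imp_mp (h : c.imp d (c.imp a b) ∈ F) (ha : c.imp d a ∈ F) : c.imp d b ∈ F :=
  hF.mp (hF.mp (hF.ipc_mem (.distrib d a b)) h) ha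

theorem imp_refl (a : A) : c.imp a a ∈ F :=
  hF.imp_mp (hF.ipc_mem (.weaken a (c.imp a a))) (hF.ipc_mem (.weaken a a))

theorem imp_trans (hab : c.imp a b ∈ F) (hbd : c.imp b d ∈ F) : c.imp a d ∈ F :=
  hF.imp_mp (hF.imp_mem_of_mem hbd) hab

theorem imp_and (hb : c.imp a b ∈ F) (hd : c.imp a d ∈ F) : c.imp a (c.and b d) ∈ F :=
  hF.imp_mp (hF.imp_trans hb (hF.ipc_mem (.and_intro b d))) hd

theorem or_imp (ha : c.imp a d ∈ F) (hb : c.imp b d ∈ F) : c.imp (c.or a b) d ∈ F :=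
  hF.mp (hF.mp (hF.ipc_mem (.or_elim a b d)) ha) hb

theorem imp_imp_iff_and_imp : c.imp a (c.imp b d) ∈ F ↔ c.imp (c.and a b) d ∈ F := by
  have hl := hF.ipc_mem (.and_left a b)
  have hr := hF.ipc_mem (.and_right a b)
  refine ⟨fun h => hF.imp_mp (hF.imp_trans hl h) hr, fun h => ?_⟩
  exact hF.imp_trans (hF.ipc_mem (.and_intro a b))
    (hF.mp (hF.ipc_mem (.distrib b (c.and a b) d)) (hF.imp_mem_of_mem h))

theorem and_imp_and (ha : c.imp a a' ∈ F) (hb : c.imp b b' ∈ F) :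
    c.imp (c.and a b) (c.and a' b') ∈ F :=
  hF.imp_and (hF.imp_trans (hF.ipc_mem (.and_left a b)) ha)
    (hF.imp_trans (hF.ipc_mem (.and_right a b)) hb)

theorem or_imp_or (ha : c.imp a a' ∈ F) (hb : c.imp b b' ∈ F) :
    c.imp (c.or a b) (c.or a' b') ∈ F :=
  hF.or_imp (hF.imp_trans ha (hF.ipc_mem (.or_left a' b')))
    (hF.imp_trans hb (hF.ipc_mem (.or_right a' b')))

theorem imp_imp_imp (ha : c.imp a' a ∈ F) (hb : c.imp b b' ∈ F) :
    c.imp (c.imp a b) (c.imp a' b') ∈ F :=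
  hF.imp_imp_iff_and_imp.2 <| hF.imp_trans (hF.and_imp_and (hF.imp_refl _) ha) <|
    hF.imp_trans (hF.imp_imp_iff_and_imp.1 (hF.imp_refl _)) hb

theorem iff_mem : c.iff a b ∈ F ↔ c.imp a b ∈ F ∧ c.imp b a ∈ F :=
  ⟨fun h => ⟨hF.mp (hF.ipc_mem (.and_left _ _)) h, hF.mp (hF.ipc_mem (.and_right _ _)) h⟩,
    fun h => hF.mp (hF.mp (hF.ipc_mem (.and_intro _ _)) h.1) h.2⟩

theorem iff_top_mem : c.iff a c.top ∈ F ↔ a ∈ F := by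
  have htop : c.top ∈ F := hF.ipc_mem .verum
  exact hF.iff_mem.trans
    ⟨fun h => hF.mp h.2 htop, fun h => ⟨hF.imp_mem_of_mem htop, hF.imp_mem_of_mem h⟩⟩

theorem equivalence_iff : Equivalence fun a b => c.iff a b ∈ F where
  refl a := hF.iff_mem.2 ⟨hF.imp_refl a, hF.imp_refl a⟩
  symm h := hF.iff_mem.2 (hF.iff_mem.1 h).symm
  trans h h' := by
    rw [hF.iff_mem] at h h' ⊢
    exact ⟨hF.imp_trans h.1 h'.1, hF.imp_trans h'.2 h.2⟩

theorem iff_and_and (ha : c.iff a a' ∈ F) (hb : c.iff b b' ∈ F) :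
    c.iff (c.and a b) (c.and a' b') ∈ F := by
  rw [hF.iff_mem] at ha hb ⊢
  exact ⟨hF.and_imp_and ha.1 hb.1, hF.and_imp_and ha.2 hb.2⟩

theorem iff_or_or (ha : c.iff a a' ∈ F) (hb : c.iff b b' ∈ F) :
    c.iff (c.or a b) (c.or a' b') ∈ F := by
  rw [hF.iff_mem] at ha hb ⊢
  exact ⟨hF.or_imp_or ha.1 hb.1, hF.or_imp_or ha.2 hb.2⟩

theorem iff_imp_imp (ha : c.iff a a' ∈ F) (hb : c.iff b b' ∈ F) :
    c.iff (c.imp a b) (c.imp a' b') ∈ F := by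
  rw [hF.iff_mem] at ha hb ⊢
  exact ⟨hF.imp_imp_imp ha.2 hb.1, hF.imp_imp_imp ha.1 hb.2⟩

/-- The Heyting algebra given by a deductive filter in which equivalent elements are equal. -/
abbrev heytingAlgebra (heq : ∀ a b, c.iff a b ∈ F → a = b) : HeytingAlgebra A where
  le a b := c.imp a b ∈ F
  le_refl := hF.imp_refl
  le_trans _ _ _ := hF.imp_trans
  le_antisymm a b hab hba := heq a b (hF.iff_mem.2 ⟨hab, hba⟩)
  inf := c.and
  inf_le_left a b := hF.ipc_mem (.and_left a b)
  inf_le_right a b := hF.ipc_mem (.and_right a b)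
  le_inf _ _ _ := hF.imp_and
  sup := c.or
  le_sup_left a b := hF.ipc_mem (.or_left a b)
  le_sup_right a b := hF.ipc_mem (.or_right a b)
  sup_le _ _ _ := hF.or_imp
  top := c.top
  le_top _ := hF.imp_mem_of_mem (hF.ipc_mem .verum)
  bot := c.bot
  bot_le a := hF.ipc_mem (.falsum a)
  himp := c.imp
  le_himp_iff _ _ _ := hF.imp_imp_iff_and_imp
  compl a := c.imp a c.bot
  himp_bot _ := rfl

end IsFilter

end Connectives

section Operations

variable {A B : Type*}

theorem comp_vec₁ (f : A → B) (a : A) : f ∘ ![a] = ![f a] :=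
  (FinVec.map_eq f ![a]).symm

theorem comp_vec₂ (f : A → B) (a b : A) : f ∘ ![a, b] = ![f a, f b] :=
  (FinVec.map_eq f ![a, b]).symm

theorem eq_vec₁ (x : Fin 1 → A) : x = ![x 0] :=
  (FinVec.etaExpand_eq x).symm

theorem eq_vec₂ (x : Fin 2 → A) : x = ![x 0, x 1] :=
  (FinVec.etaExpand_eq x).symm

/-- The value of terms under a valuation, as a homomorphism from the algebra of terms. -/
def realizeHom {ℒ : FirstOrder.Language.{u, 0}} {V : Type u} [ℒ.Structure A] (v : V → A) :
    ℒ.Term V →[ℒ] A where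
  toFun φ := φ.realize v
  map_fun' _ _ := rfl
  map_rel' _ _ h := h.elim

/-- The operations of a structure for the language of intuitionistic logic. -/
def IntL.connectives (A : Type*) [intLang.{u}.Structure A] : Connectives A where
  bot := Structure.funMap (L := intLang) (n := 0) IntConn.bot ![]
  top := Structure.funMap (L := intLang) (n := 0) IntConn.top ![]
  and a b := Structure.funMap (L := intLang) (n := 2) IntConn.and ![a, b]
  or a b := Structure.funMap (L := intLang) (n := 2) IntConn.or ![a, b]
  imp a b := Structure.funMap (L := intLang) (n := 2) IntConn.imp ![a, b]

theorem IntL.isHom_connectives [intLang.{u}.Structure A] [intLang.{u}.Structure B]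
    (f : A →[intLang.{u}] B) : (connectives A).IsHom (connectives B) f where
  map_bot := HomClass.map_constants (L := intLang) f IntConn.bot
  map_top := HomClass.map_constants (L := intLang) f IntConn.top
  map_and a b := (HomClass.map_fun f _ _).trans (congrArg _ (comp_vec₂ f a b))
  map_or a b := (HomClass.map_fun f _ _).trans (congrArg _ (comp_vec₂ f a b))
  map_imp a b := (HomClass.map_fun f _ _).trans (congrArg _ (comp_vec₂ f a b))

/-- Operations interpreting the connectives of modal logic. -/
structure ModalConnectives (ι A : Type*) extends Connectives A where
  neg : A → A
  dia : ι → A → A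
  imp_eq : ∀ a b, imp a b = or (neg a) b

/-- The dual `□ᵢ = ¬◇ᵢ¬` of `◇ᵢ`. -/
def ModalConnectives.box {ι : Type*} (c : ModalConnectives ι A) (i : ι) (a : A) : A :=
  c.neg (c.dia i (c.neg a))

namespace ModL

variable {ι : Type u}

/-- The operations of a structure for the language of modal logic. -/
def connectives (ι A : Type u) [(modLang ι).Structure A] : ModalConnectives ι A where
  bot := Structure.funMap (L := modLang ι) (n := 0) ModConn.bot ![]
  top := Structure.funMap (L := modLang ι) (n := 0) ModConn.top ![]
  neg a := Structure.funMap (L := modLang ι) (n := 1) ModConn.neg ![a]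
  dia := diaMap
  and a b := Structure.funMap (L := modLang ι) (n := 2) ModConn.and ![a, b]
  or a b := Structure.funMap (L := modLang ι) (n := 2) ModConn.or ![a, b]
  imp a b := Structure.funMap (L := modLang ι) (n := 2) ModConn.or
    ![Structure.funMap (L := modLang ι) (n := 1) ModConn.neg ![a], b]
  imp_eq _ _ := rfl

section Hom

variable {A B : Type u} [(modLang ι).Structure A] [(modLang ι).Structure B]
  (f : A →[modLang ι] B)

theorem map_neg (a : A) : f ((connectives ι A).neg a) = (connectives ι B).neg (f a) :=
  (HomClass.map_fun f _ _).trans (congrArg _ (comp_vec₁ f a))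

theorem map_dia (i : ι) (a : A) : f ((connectives ι A).dia i a) = (connectives ι B).dia i (f a) :=
  (HomClass.map_fun f _ _).trans (congrArg _ (comp_vec₁ f a))

theorem map_box (i : ι) (a : A) :
    f ((connectives ι A).box i a) = (connectives ι B).box i (f a) := by
  simp only [ModalConnectives.box, map_neg, map_dia]

theorem isHom_connectives : (connectives ι A).IsHom (connectives ι B).toConnectives f where
  map_bot := HomClass.map_constants (L := modLang ι) f ModConn.bot
  map_top := HomClass.map_constants (L := modLang ι) f ModConn.top
  map_and a b := (HomClass.map_fun f _ _).trans (congrArg _ (comp_vec₂ f a b))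
  map_or a b := (HomClass.map_fun f _ _).trans (congrArg _ (comp_vec₂ f a b))
  map_imp a b := (HomClass.map_fun f _ _).trans
    (congrArg _ ((comp_vec₂ f _ b).trans (congrArg (![·, f b]) (map_neg f a))))

end Hom

end ModL

/-- The operations of a structure for the language of a logical system. -/
def Kind.connectives : (k : Kind.{u}) → (A : Type u) → [k.lang.Structure A] → Connectives A
  | .intuitionistic, A, s => @IntL.connectives A s
  | .modal ι, A, s => (@ModL.connectives ι A s).toConnectives

variable {k : Kind.{u}} {V : Type u} {A B : Type u} [sA : k.lang.Structure A]
  [sB : k.lang.Structure B]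

theorem Kind.isHom_connectives (f : A →[k.lang] B) :
    (k.connectives A).IsHom (k.connectives B) f := by
  cases k with
  | intuitionistic => exact @IntL.isHom_connectives A B sA sB f
  | modal ι => exact @ModL.isHom_connectives ι A B sA sB f

theorem Kind.connectives_top : (k.connectives A).top = (k.one : A) := by
  cases k <;> exact congrArg (@Structure.funMap _ A sA 0 _) (Subsingleton.elim ![] default)

theorem realize_iff (s t : k.lang.Term V) (v : V → A) :
    ((k.connectives (k.lang.Term V)).iff s t).realize v =
      (k.connectives A).iff (s.realize v) (t.realize v) :=
  (k.isHom_connectives (realizeHom v)).map_iff s t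

end Operations

section Filters

namespace ModalConnectives

variable {ι A : Type*} (c : ModalConnectives ι A)

/-- A deductive filter for modal logic: a set that contains the values of the axioms of the least
normal modal logic and is closed under modus ponens and necessitation. The fields `em_mem` and
`contradiction_mem` complete the intuitionistic axioms to the classical ones. -/
structure IsFilter (F : Set A) : Prop extends c.toConnectives.IsFilter F where
  em_mem : ∀ a, c.or a (c.neg a) ∈ F
  contradiction_mem : ∀ a, c.imp a (c.imp (c.neg a) c.bot) ∈ F
  normal_mem : ∀ i a b, c.imp (c.box i (c.imp a b)) (c.imp (c.box i a) (c.box i b)) ∈ F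
  dual_mem : ∀ i a, c.iff (c.dia i a) (c.neg (c.box i (c.neg a))) ∈ F
  nec : ∀ i, ∀ a ∈ F, c.box i a ∈ F

namespace IsFilter

variable {c} {F : Set A} (hF : c.IsFilter F) {a b : A}
include hF

theorem iff_neg_imp_bot (a : A) : c.iff (c.neg a) (c.imp a c.bot) ∈ F := by
  have hcomm : c.imp (c.and (c.neg a) a) (c.and a (c.neg a)) ∈ F :=
    hF.imp_and (hF.ipc_mem (.and_right _ _)) (hF.ipc_mem (.and_left _ _))
  refine hF.iff_mem.2 ⟨hF.imp_imp_iff_and_imp.2 ?_, ?_⟩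
  · exact hF.imp_trans hcomm (hF.imp_imp_iff_and_imp.1 (hF.contradiction_mem a))
  · have h := hF.or_imp (hF.imp_refl (c.neg a)) (hF.ipc_mem (.falsum (c.neg a)))
    rwa [← c.imp_eq] at h

theorem iff_neg_neg (h : c.iff a b ∈ F) : c.iff (c.neg a) (c.neg b) ∈ F :=
  have heq := hF.equivalence_iff
  heq.trans (hF.iff_neg_imp_bot a) <|
    heq.trans (hF.iff_imp_imp h (heq.refl _)) (heq.symm (hF.iff_neg_imp_bot b))

theorem box_imp_box (i : ι) (h : c.imp a b ∈ F) : c.imp (c.box i a) (c.box i b) ∈ F :=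
  hF.mp (hF.normal_mem i a b) (hF.nec i _ h)

theorem iff_box_box (i : ι) (h : c.iff a b ∈ F) : c.iff (c.box i a) (c.box i b) ∈ F := by
  rw [hF.iff_mem] at h ⊢
  exact ⟨hF.box_imp_box i h.1, hF.box_imp_box i h.2⟩

theorem iff_dia_dia (i : ι) (h : c.iff a b ∈ F) : c.iff (c.dia i a) (c.dia i b) ∈ F :=
  have heq := hF.equivalence_iff
  heq.trans (hF.dual_mem i a) <|
    heq.trans (hF.iff_neg_neg (hF.iff_box_box i (hF.iff_neg_neg h))) (heq.symm (hF.dual_mem i b))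

theorem iff_box_and (i : ι) (a b : A) :
    c.iff (c.box i (c.and a b)) (c.and (c.box i a) (c.box i b)) ∈ F := by
  refine hF.iff_mem.2 ⟨hF.imp_and ?_ ?_, hF.imp_imp_iff_and_imp.1 ?_⟩
  · exact hF.box_imp_box i (hF.ipc_mem (.and_left a b))
  · exact hF.box_imp_box i (hF.ipc_mem (.and_right a b))
  · exact hF.imp_trans (hF.box_imp_box i (hF.ipc_mem (.and_intro a b))) (hF.normal_mem i b _)

/-- The Boolean algebra given by a deductive filter in which equivalent elements are equal. -/
abbrev booleanAlgebra (heq : ∀ a b, c.iff a b ∈ F → a = b) : BooleanAlgebra A :=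
  letI : HeytingAlgebra A := hF.heytingAlgebra heq
  { GeneralizedHeytingAlgebra.toDistribLattice with
    compl := c.neg
    himp := fun a b => c.or b (c.neg a)
    bot := c.bot
    top := c.top
    inf_compl_le_bot := fun a => hF.imp_imp_iff_and_imp.1 (hF.contradiction_mem a)
    top_le_sup_compl := fun a => hF.imp_mem_of_mem (hF.em_mem a)
    le_top := fun _ => le_top
    bot_le := fun _ => bot_le }

end IsFilter

end ModalConnectives

namespace ModL

variable {ι A : Type u} [(modLang ι).Structure A] {F : Set A}
  (hF : (connectives ι A).IsFilter F)
include hF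

theorem iff_funMap {n : ℕ} (s : (modLang ι).Functions n) {x y : Fin n → A}
    (h : ∀ j, (connectives ι A).iff (x j) (y j) ∈ F) :
    (connectives ι A).iff (Structure.funMap s x) (Structure.funMap s y) ∈ F := by
  cases s with
  | bot | top => rw [Subsingleton.elim x y]; exact hF.equivalence_iff.refl _
  | neg => rw [eq_vec₁ x, eq_vec₁ y]; exact hF.iff_neg_neg (h 0)
  | dia i => rw [eq_vec₁ x, eq_vec₁ y]; exact hF.iff_dia_dia i (h 0)
  | and => rw [eq_vec₂ x, eq_vec₂ y]; exact hF.iff_and_and (h 0) (h 1)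
  | or => rw [eq_vec₂ x, eq_vec₂ y]; exact hF.iff_or_or (h 0) (h 1)

theorem isAlgebra (heq : ∀ a b, (connectives ι A).iff a b ∈ F → a = b) :
    IsAlgebra (ι := ι) A := by
  let _ : BooleanAlgebra A := hF.booleanAlgebra heq
  let c := connectives ι A
  have box_top (i : ι) : c.box i (⊤ : A) = ⊤ :=
    heq _ _ (hF.iff_top_mem.2 (hF.nec i _ (hF.ipc_mem .verum)))
  have box_inf (i : ι) (a b : A) : c.box i (a ⊓ b) = c.box i a ⊓ c.box i b :=
    heq _ _ (hF.iff_box_and i a b)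
  have dia_eq (i : ι) (a : A) : diaMap i a = (c.box i aᶜ)ᶜ := heq _ _ (hF.dual_mem i a)
  refine ⟨inferInstance, rfl, rfl, fun _ => rfl, fun _ _ => rfl, fun _ _ => rfl, ?_, ?_⟩
  · exact fun i => by rw [dia_eq, compl_bot, box_top, compl_top]
  · exact fun i a b => by rw [dia_eq, dia_eq, dia_eq, compl_sup, box_inf, compl_inf]

end ModL

namespace IntL

variable {A : Type u} [intLang.{u}.Structure A] {F : Set A} (hF : (connectives A).IsFilter F)
include hF

theorem iff_funMap {n : ℕ} (s : intLang.{u}.Functions n) {x y : Fin n → A}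
    (h : ∀ j, (connectives A).iff (x j) (y j) ∈ F) :
    (connectives A).iff (Structure.funMap s x) (Structure.funMap s y) ∈ F := by
  cases s with
  | bot | top => rw [Subsingleton.elim x y]; exact hF.equivalence_iff.refl _
  | and => rw [eq_vec₂ x, eq_vec₂ y]; exact hF.iff_and_and (h 0) (h 1)
  | or => rw [eq_vec₂ x, eq_vec₂ y]; exact hF.iff_or_or (h 0) (h 1)
  | imp => rw [eq_vec₂ x, eq_vec₂ y]; exact hF.iff_imp_imp (h 0) (h 1)

theorem isAlgebra (heq : ∀ a b, (connectives A).iff a b ∈ F → a = b) : IsAlgebra A :=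
  ⟨hF.heytingAlgebra heq, rfl, rfl, fun _ _ => rfl, fun _ _ => rfl, fun _ _ => rfl⟩

end IntL

end Filters

section DeductiveFilters

variable {k : Kind.{u}} {V : Type u} {A : Type u} {L : Set (k.lang.Term V)}

theorem exists_valuation_mem_range [Infinite V] (a b d : A) :
    ∃ v : V → A, a ∈ Set.range v ∧ b ∈ Set.range v ∧ d ∈ Set.range v := by
  obtain ⟨g, hg, -⟩ := exists_injOn_mapsTo_compl (β := V) (Set.toFinite {a, b, d}) Set.finite_empty
  have : Nonempty A := ⟨a⟩
  obtain ⟨v, hv⟩ := exists_eqOn_comp hg id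
  exact ⟨v, ⟨g a, hv (by simp)⟩, ⟨g b, hv (by simp)⟩, ⟨g d, hv (by simp)⟩⟩

theorem IntL.IsLogic.isFilter {L : Set (intLang.{u}.Term V)} (hL : IsLogic L) :
    (connectives (intLang.{u}.Term V)).IsFilter L where
  ipc_mem h := hL.ipc _ (by cases h <;> constructor)
  mp := hL.mp _ _

theorem ModL.IsLogic.mem_of_forall_assignment {ι : Type u} {L : Set ((modLang ι).Term V)}
    (hL : IsLogic L) {φ : (modLang ι).Term V} (h : let c := connectives ι ((modLang ι).Term V)
      ∀ w : (modLang ι).Term V → Prop, ¬w c.bot → w c.top → (∀ a, w (c.neg a) ↔ ¬w a) →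
      (∀ a b, w (c.and a b) ↔ w a ∧ w b) → (∀ a b, w (c.or a b) ↔ w a ∨ w b) →
      (∀ a b, w (c.imp a b) ↔ (w a → w b)) → w φ) : φ ∈ L := by
  refine hL.taut φ fun w hbot htop hneg hand hor =>
    h w hbot.1 (htop.2 trivial) hneg hand hor fun a b => ?_
  rw [imp_iff_not_or, ← hneg]
  exact hor _ _

theorem ModL.IsLogic.isFilter {ι : Type u} {L : Set ((modLang ι).Term V)} (hL : IsLogic L) :
    (connectives ι ((modLang ι).Term V)).IsFilter L where
  ipc_mem hφ := hL.mem_of_forall_assignment fun w hbot htop _ hand hor himp => by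
    cases hφ with
    | verum => exact htop
    | _ => simp only [hbot, hand, hor, himp]; tauto
  mp := hL.mp _ _
  em_mem a := hL.mem_of_forall_assignment fun w _ _ hneg _ hor _ => by
    rw [hor, hneg]; exact em (w a)
  contradiction_mem a := hL.mem_of_forall_assignment fun w _ _ hneg _ _ himp => by
    rw [himp, himp, hneg]; exact fun h h' => (h' h).elim
  normal_mem := hL.normal
  dual_mem := hL.dual
  nec := hL.nec

theorem Kind.isFilter_of_isLogic (hL : k.IsLogic L) :
    (k.connectives (k.lang.Term V)).IsFilter L := by
  cases k with
  | intuitionistic => exact IntL.IsLogic.isFilter hL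
  | modal ι => exact (ModL.IsLogic.isFilter hL).toIsFilter

theorem Kind.thm_mem_rules {φ : k.lang.Term V} (hφ : φ ∈ L) :
    pi1Rule ∅ Set.finite_empty φ ∈ k.rules L := by
  cases k <;> exact .thm φ hφ

theorem Kind.modusPonens_mem_rules (a b : k.lang.Term V) :
    pi1Rule {a, (k.connectives _).imp a b} (Set.toFinite _) b ∈ k.rules L := by
  cases k <;> exact .mp a b

theorem Kind.bound_of_mem_rules {r : Pi2Rule k.lang V} (hr : r ∈ k.rules L) : r.bound = ∅ := by
  cases k <;> cases hr <;> rfl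

variable [sA : k.lang.Structure A] {F : Set A}

/-- A deductive filter of the logic `L` on an algebra: a set closed under the rules of `L`, under
every valuation. The algebras of `L` are those for which `{1}` is a deductive filter and
equivalent elements are equal. -/
def IsDeductiveFilter (L : Set (k.lang.Term V)) (F : Set A) : Prop :=
  ∀ r ∈ k.rules L, ∀ v : V → A, (∀ φ ∈ r.prem, φ.realize v ∈ F) → r.concl.realize v ∈ F

theorem isDeductiveFilter_singleton_one_iff :
    IsDeductiveFilter L {(k.one : A)} ↔ ∀ r ∈ k.rules L, Validates A r := by
  refine forall₂_congr fun r hr => forall_congr' fun v => imp_congr_left ?_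
  refine forall₂_congr fun φ _ => ⟨fun h v' hv' => ?_, fun h => h v fun _ _ => rfl⟩
  obtain rfl : v' = v := funext fun p => hv' p (by simp [Kind.bound_of_mem_rules hr])
  exact h

namespace IsDeductiveFilter

theorem realize_mem (hF : IsDeductiveFilter L F) {φ : k.lang.Term V} (hφ : φ ∈ L) (v : V → A) :
    φ.realize v ∈ F :=
  hF _ (Kind.thm_mem_rules hφ) v fun _ h => h.elim

variable [Infinite V]

theorem isFilter (hL : k.IsLogic L) (hF : IsDeductiveFilter L F) :
    (k.connectives A).IsFilter F where
  ipc_mem {a} ha := by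
    obtain ⟨v, φ, hφ, rfl⟩ := ha.exists_eq (fun v : V → A => k.isHom_connectives (realizeHom v))
      fun x y z => by
        obtain ⟨v, ⟨p, hp⟩, ⟨q, hq⟩, ⟨r, hr⟩⟩ := exists_valuation_mem_range (V := V) x y z
        exact ⟨v, ⟨.var p, hp⟩, ⟨.var q, hq⟩, ⟨.var r, hr⟩⟩
    exact hF.realize_mem ((Kind.isFilter_of_isLogic hL).ipc_mem hφ) v
  mp {a b} hab ha := by
    obtain ⟨v, ⟨p, rfl⟩, ⟨q, rfl⟩, -⟩ := exists_valuation_mem_range (V := V) a b a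
    refine hF _ (Kind.modusPonens_mem_rules (.var p) (.var q)) v ?_
    rintro _ (rfl | rfl)
    · exact ha
    · have h := (k.isHom_connectives (realizeHom v)).map_imp (.var p) (.var q)
      exact (congrArg (· ∈ F) h).mpr hab

theorem isFilter_modal {ι : Type u} [s : (modLang ι).Structure A] {L : Set ((modLang ι).Term V)}
    (hL : ModL.IsLogic L) (hF : @IsDeductiveFilter (.modal ι) V A s L F) :
    (ModL.connectives ι A).IsFilter F := by
  have hom (v : V → A) := ModL.isHom_connectives (realizeHom (ℒ := modLang ι) v)
  have thm_mem {φ} (hφ : φ ∈ L) (v : V → A) : realizeHom v φ ∈ F :=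
    @realize_mem (.modal ι) V A L s F hF φ hφ v
  refine ⟨@isFilter (.modal ι) V A L s F _ hL hF, ?_, ?_, ?_, ?_, ?_⟩
  · intro a
    obtain ⟨v, ⟨p, rfl⟩, -⟩ := exists_valuation_mem_range (V := V) a a a
    have h := thm_mem (hL.isFilter.em_mem (.var p)) v
    rwa [(hom v).map_or, ModL.map_neg] at h
  · intro a
    obtain ⟨v, ⟨p, rfl⟩, -⟩ := exists_valuation_mem_range (V := V) a a a
    have h := thm_mem (hL.isFilter.contradiction_mem (.var p)) v
    rwa [(hom v).map_imp, (hom v).map_imp, ModL.map_neg, (hom v).map_bot] at h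
  · intro i a b
    obtain ⟨v, ⟨p, rfl⟩, ⟨q, rfl⟩, -⟩ := exists_valuation_mem_range (V := V) a b a
    have h := thm_mem (hL.isFilter.normal_mem i (.var p) (.var q)) v
    rwa [(hom v).map_imp, (hom v).map_imp, ModL.map_box, ModL.map_box, ModL.map_box,
      (hom v).map_imp] at h
  · intro i a
    obtain ⟨v, ⟨p, rfl⟩, -⟩ := exists_valuation_mem_range (V := V) a a a
    have h := thm_mem (hL.isFilter.dual_mem i (.var p)) v
    rwa [(hom v).map_iff, ModL.map_neg, ModL.map_box, ModL.map_neg, ModL.map_dia] at h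
  · intro i a ha
    obtain ⟨v, ⟨p, rfl⟩, -⟩ := exists_valuation_mem_range (V := V) a a a
    have h := hF _ (.nec i (.var p)) v (by rintro _ rfl; exact ha)
    exact (ModL.map_box (realizeHom v) i (.var p)) ▸ h

theorem iff_funMap (hL : k.IsLogic L) (hF : IsDeductiveFilter L F) {n : ℕ}
    (s : k.lang.Functions n) {x y : Fin n → A} (h : ∀ j, (k.connectives A).iff (x j) (y j) ∈ F) :
    (k.connectives A).iff (Structure.funMap s x) (Structure.funMap s y) ∈ F := by
  cases k with
  | intuitionistic => exact @IntL.iff_funMap A sA F (hF.isFilter hL) n s x y h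
  | modal ι => exact @ModL.iff_funMap ι A sA F (@isFilter_modal V A F _ ι sA L hL hF) n s x y h

theorem isAlgebra (hL : k.IsLogic L) (hF : IsDeductiveFilter L F)
    (heq : ∀ a b, (k.connectives A).iff a b ∈ F → a = b) : k.IsAlgebra A sA := by
  cases k with
  | intuitionistic => exact @IntL.isAlgebra A sA F (hF.isFilter hL) heq
  | modal ι => exact @ModL.isAlgebra ι A sA F (@isFilter_modal V A F _ ι sA L hL hF) heq

end IsDeductiveFilter

end DeductiveFilters

section LAlgebras

variable {k : Kind.{u}} {V : Type u} {L : Set (k.lang.Term V)}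

namespace Kind.IsAlgebra

variable {A : Type u} [sA : k.lang.Structure A] (hA : k.IsAlgebra A sA) {a b : A}
include hA

theorem exists_heytingAlgebra : ∃ _ : HeytingAlgebra A, (k.connectives A).top = ⊤ ∧
    (∀ a b, (k.connectives A).and a b = a ⊓ b) ∧ ∀ a b, (k.connectives A).imp a b = a ⇨ b := by
  cases k with
  | intuitionistic =>
    obtain ⟨_, -, htop, hand, -, himp⟩ := hA
    exact ⟨inferInstance, htop, hand, himp⟩
  | modal ι =>
    obtain ⟨_, -, htop, hneg, hand, hor, -⟩ := hA
    exact ⟨inferInstance, htop, hand, fun a b =>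
      (congrArg₂ _ rfl (congrArg (![·, b]) (hneg a))).trans <|
        (hor aᶜ b).trans <| (sup_comm _ _).trans himp_eq.symm⟩

theorem iff_eq_one_iff : (k.connectives A).iff a b = k.one ↔ a = b := by
  obtain ⟨_, htop, hand, himp⟩ := hA.exists_heytingAlgebra
  rw [← Kind.connectives_top, htop, Connectives.iff, hand, himp, himp, inf_eq_top_iff,
    himp_eq_top_iff, himp_eq_top_iff, le_antisymm_iff]

theorem trueAt_iff_iff {W : Type u} {s t : k.lang.Term W} {v : W → A} :
    TrueAt v ((k.connectives (k.lang.Term W)).iff s t) ↔ s.realize v = t.realize v := by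
  rw [TrueAt, realize_iff, hA.iff_eq_one_iff]

theorem eq_one_of_imp_eq_one (ha : a = k.one) (h : (k.connectives A).imp a b = k.one) :
    b = k.one := by
  obtain ⟨_, htop, -, himp⟩ := hA.exists_heytingAlgebra
  rw [← Kind.connectives_top, htop] at ha h ⊢
  rwa [himp, ha, top_himp] at h

end Kind.IsAlgebra

theorem ModL.IsAlgebra.box_top {ι A : Type u} [(modLang ι).Structure A]
    (hA : IsAlgebra (ι := ι) A) (i : ι) :
    (connectives ι A).box i (connectives ι A).top = (connectives ι A).top := by
  obtain ⟨_, -, htop, hneg, -, -, hdia, -⟩ := hA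
  have htop : (connectives ι A).top = ⊤ := htop
  have hneg (a) : (connectives ι A).neg a = aᶜ := hneg a
  have hdia : (connectives ι A).dia i ⊥ = ⊥ := hdia i
  rw [htop, ModalConnectives.box, hneg, hneg, compl_top, hdia, compl_bot]

theorem ModL.IsAlgebra.realize_box {ι A : Type u} [(modLang ι).Structure A]
    (hA : IsAlgebra (ι := ι) A) (i : ι) {φ : (modLang ι).Term V} {v : V → A}
    (h : φ.realize v = (connectives ι A).top) : (box i φ).realize v = (connectives ι A).top :=
  (map_box (realizeHom v) i φ).trans <| (congrArg _ h).trans (hA.box_top i)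

namespace LAlgebra

theorem isDeductiveFilter_one (A : LAlgebra L) :
    IsDeductiveFilter L {(k.one : A.carrier)} := by
  obtain ⟨A, hA, hmodels⟩ := A
  rename k.lang.Structure A => sA
  intro r hr v hv
  have mp {a b : k.lang.Term V} (ha : a.realize v = (k.one : A))
      (hab : ((k.connectives _).imp a b).realize v = (k.one : A)) : b.realize v = (k.one : A) :=
    hA.eq_one_of_imp_eq_one ha (((k.isHom_connectives (realizeHom v)).map_imp a b).symm.trans hab)
  cases k with
  | intuitionistic =>
    cases hr with
    | thm φ hφ => exact hmodels φ hφ v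
    | mp a b => exact mp (hv a (.inl rfl)) (hv _ (.inr rfl))
  | modal ι =>
    cases hr with
    | thm φ hφ => exact hmodels φ hφ v
    | mp a b => exact mp (hv a (.inl rfl)) (hv _ (.inr rfl))
    | nec i a =>
      have htop : (@ModL.connectives ι A sA).top = (Kind.one (.modal ι) : A) :=
        Kind.connectives_top (k := .modal ι)
      exact (@ModL.IsAlgebra.realize_box V ι A sA hA i a v ((hv a rfl).trans htop.symm)).trans htop

theorem validates_rules (A : LAlgebra L) {r : Pi2Rule k.lang V} (hr : r ∈ k.rules L) :
    Validates A.carrier r :=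
  isDeductiveFilter_singleton_one_iff.1 A.isDeductiveFilter_one r hr

/-- A structure that validates the rules of the logic and in which equivalent elements are equal,
as an algebra of the logic. -/
def ofValidates [Infinite V] (hL : k.IsLogic L) (A : Type u) [k.lang.Structure A]
    (hA : ∀ r ∈ k.rules L, Validates A r)
    (heq : ∀ a b : A, (k.connectives A).iff a b = k.one → a = b) : LAlgebra L where
  carrier := A
  isAlgebra := (isDeductiveFilter_singleton_one_iff.2 hA).isAlgebra hL heq
  models _ hφ := (isDeductiveFilter_singleton_one_iff.2 hA).realize_mem hφ

variable [Infinite V] (hL : k.IsLogic L) {I : Type u} (B : I → LAlgebra L)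

/-- The direct product of a family of algebras of a logic. -/
def pi : LAlgebra L :=
  ofValidates hL (∀ i, (B i).carrier)
    (fun _ hr => Validates.pi fun i => (B i).validates_rules hr) fun a b h => funext fun i => by
      let π := projection (ℒ := k.lang) (fun i => (B i).carrier) i
      have h' := congrArg π h
      rw [(k.isHom_connectives π).map_iff, map_one] at h'
      exact (B i).isAlgebra.iff_eq_one_iff.1 h'

/-- The ultraproduct of a family of algebras of a logic. -/
def ultraproduct (U : Ultrafilter I) : LAlgebra L :=
  ofValidates hL ((U : Filter I).Product fun i => (B i).carrier)
    (fun _ hr => Validates.ultraproduct fun i => (B i).validates_rules hr) fun a b h => by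
      obtain ⟨v, ⟨p, rfl⟩, ⟨q, rfl⟩, -⟩ := exists_valuation_mem_range (V := V) a b a
      obtain ⟨w, rfl⟩ := exists_eq_ultraMk_comp v
      have hw := trueAt_ultraMk_iff.1 ((realize_iff (.var p) (.var q) _).trans h)
      refine (realize_ultraMk_eq_iff (ℒ := k.lang) (.var p) (.var q) w).2 (hw.mono fun i hi => ?_)
      exact (B i).isAlgebra.trueAt_iff_iff.1 hi

include hL in
theorem exists_quotient {A : Type u} [sA : k.lang.Structure A] {F : Set A}
    (hF : IsDeductiveFilter L F) : ∃ (Q : LAlgebra L) (π : A → Q.carrier), Function.Surjective π ∧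
      ∀ (v : V → A) (φ : k.lang.Term V), TrueAt (fun p => π (v p)) φ ↔ φ.realize v ∈ F := by
  let s : Setoid A := ⟨fun a b => (k.connectives A).iff a b ∈ F, (hF.isFilter hL).equivalence_iff⟩
  let _ : k.lang.Prestructure s :=
    { toStructure := sA
      fun_equiv := fun _ _ => hF.iff_funMap hL _
      rel_equiv := fun {_ r} => isEmptyElim r }
  let π : A → Quotient s := Quotient.mk s
  have trueAt_iff (v : V → A) (φ : k.lang.Term V) :
      TrueAt (fun p => π (v p)) φ ↔ φ.realize v ∈ F := by
    rw [TrueAt, ← realize_one fun p => π (v p), Term.realize_quotient_mk' s,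
      Term.realize_quotient_mk' s, Quotient.eq]
    change (k.connectives A).iff (φ.realize v) (k.one.term.realize v) ∈ F ↔ _
    rw [realize_one, ← Kind.connectives_top]
    exact (hF.isFilter hL).iff_top_mem
  refine ⟨ofValidates hL (Quotient s) (isDeductiveFilter_singleton_one_iff.1 ?_) ?_, π,
    Quotient.mk_surjective, trueAt_iff⟩
  · intro r hr v hv
    obtain ⟨v, rfl⟩ := Quotient.mk_surjective.comp_left v
    exact (trueAt_iff v _).2 (hF r hr v fun φ hφ => (trueAt_iff v φ).1 (hv φ hφ))
  · intro a b h
    obtain ⟨v, ⟨p, rfl⟩, ⟨q, rfl⟩, -⟩ := exists_valuation_mem_range (V := V) a b a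
    obtain ⟨v, rfl⟩ := Quotient.mk_surjective.comp_left v
    exact Quotient.sound <| (congrArg (· ∈ F) (realize_iff (.var p) (.var q) v)).mp <|
      (trueAt_iff v _).1 ((realize_iff (.var p) (.var q) _).trans h)

end LAlgebra

end LAlgebras

section Completeness

variable {k : Kind.{u}} {V : Type u}

theorem vars_one : vars (k.one.term : k.lang.Term V) = ∅ := by
  simp [Constants.term, vars_func]

open Classical in
/-- The substitution that replaces the variables of `P` by `1`. -/
noncomputable def eraseVars (P : Set V) : V → k.lang.Term V :=
  P.piecewise (fun _ => k.one.term) .var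

theorem eraseVars_of_notMem {P : Set V} {p : V} (hp : p ∉ P) :
    eraseVars (k := k) P p = .var p := by
  simp [eraseVars, hp]

theorem disjoint_vars_subst_eraseVars (P : Set V) (φ : k.lang.Term V) :
    Disjoint P (vars (φ.subst (eraseVars P))) := by
  refine Set.disjoint_left.2 fun q hq hq' => ?_
  obtain ⟨p, -, hp⟩ := mem_vars_subst.1 hq'
  by_cases h : p ∈ P
  · simp [eraseVars, h, vars_one] at hp
  · rw [eraseVars_of_notMem h, vars_var] at hp
    exact h (hp ▸ hq)

theorem subst_eraseVars {P : Set V} {φ : k.lang.Term V} (h : Disjoint P (vars φ)) :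
    φ.subst (eraseVars P) = φ :=
  (subst_congr fun _ hp => eraseVars_of_notMem (Set.disjoint_right.1 h hp)).trans (subst_var φ)

namespace IsPi2RuleSystem

variable {S : Set (Pi2Rule k.lang V)} {d : Pi2Rule k.lang V}

theorem exists_subst_mem (hS : IsPi2RuleSystem S) (hd : d ∈ S) {σ : V → k.lang.Term V}
    (hfix : ∀ p ∈ d.bound, σ p = .var p)
    (hfresh : ∀ q ∉ d.bound, Disjoint d.bound (vars (σ q))) :
    ∃ d' ∈ S, d'.prem = substSet σ d.prem ∧ d'.concl = d.concl.subst σ ∧ d'.bound = d.bound := by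
  have hconcl : Disjoint d.bound (vars (d.concl.subst σ)) := by
    rw [vars_subst, Set.disjoint_iUnion₂_right]
    exact fun p hp => hfresh p (Set.disjoint_right.1 d.bound_concl hp)
  exact ⟨⟨substSet σ d.prem, d.concl.subst σ, d.bound, d.prem_finite.image _, d.bound_finite,
    hconcl⟩, hS.bound_structurality d _ σ hd hfix (fun q hq => hfresh q hq.2) rfl rfl rfl,
    rfl, rfl, rfl⟩

variable [Infinite V]

theorem exists_alphaVariant_mem (hS : IsPi2RuleSystem S) (hd : d ∈ S) {X : Set V}
    (hX : X.Finite) : ∃ d' ∈ S, ∃ ρ : V → V, (∀ p ∉ d.bound, ρ p = p) ∧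
      d'.prem = substSet (fun p => .var (ρ p)) d.prem ∧ d'.concl = d.concl ∧
      d'.bound = ρ '' d.bound ∧ Disjoint d'.bound X := by
  classical
  obtain ⟨g, hg, hgX⟩ := exists_injOn_mapsTo_compl d.bound_finite <|
    (hX.union (finite_varsOf d.prem_finite)).union (finite_vars d.concl)
  let ρ : V → V := d.bound.piecewise g id
  have hρ : Set.EqOn ρ g d.bound := Set.piecewise_eqOn _ _ _
  have hfix : ∀ p ∉ d.bound, ρ p = p := Set.piecewise_eqOn_compl _ _ _
  have hfresh : Disjoint (ρ '' d.bound) (X ∪ varsOf d.prem ∪ vars d.concl) := by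
    rw [hρ.image_eq]
    exact Set.disjoint_left.2 hgX.image_subset
  have hconcl : Disjoint (ρ '' d.bound) (vars d.concl) := hfresh.mono_right Set.subset_union_right
  refine ⟨⟨substSet (fun p => .var (ρ p)) d.prem, d.concl, ρ '' d.bound, d.prem_finite.image _,
    d.bound_finite.image _, hconcl⟩, ?_, ρ, hfix, rfl, rfl, rfl,
    hfresh.mono_right fun p hp => .inl (.inl hp)⟩
  exact hS.alpha_renaming d _ ρ hd (hg.congr hρ.symm) hfix
    (hfresh.mono_right fun p hp => .inl (.inr hp.1)) hconcl rfl rfl rfl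

theorem exists_substInstance_mem [∀ p, Decidable (p ∈ d.bound)] (hS : IsPi2RuleSystem S)
    (hd : d ∈ S) (σ : V → k.lang.Term V) {X : Set V} (hX : X.Finite) :
    ∃ d' ∈ S, ∃ ρ : V → V,
      d'.prem = substSet (d.bound.piecewise (fun p => .var (ρ p)) σ) d.prem ∧
      d'.concl = d.concl.subst σ ∧ d'.bound = ρ '' d.bound ∧ Disjoint d'.bound X := by
  classical
  let D : Set V := varsOf d.prem ∪ vars d.concl
  have hD : D.Finite := (finite_varsOf d.prem_finite).union (finite_vars _)
  obtain ⟨e, he, ρ, hfix, hprem, hconcl, hbound, hfresh⟩ := hS.exists_alphaVariant_mem hd <|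
    (hX.union hD).union (hD.biUnion fun p _ => finite_vars (σ p))
  -- Restricting `σ` to the free variables of `d` keeps the new bound variables fixed.
  let σ' : V → k.lang.Term V := (D \ d.bound).piecewise σ .var
  have hσ' : Set.EqOn σ' σ (D \ d.bound) := Set.piecewise_eqOn _ _ _
  have hσ'_bound : ∀ p ∈ e.bound, σ' p = .var p := fun p hp =>
    Set.piecewise_eq_of_notMem _ _ _ fun h => Set.disjoint_left.1 hfresh hp (.inl (.inr h.1))
  have hσ'_fresh : ∀ q ∉ e.bound, Disjoint e.bound (vars (σ' q)) := by
    intro q hq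
    by_cases hqD : q ∈ D \ d.bound
    · rw [hσ' hqD]
      exact hfresh.mono_right fun p hp => .inr (Set.mem_biUnion hqD.1 hp)
    · rw [show σ' q = .var q from Set.piecewise_eq_of_notMem _ _ _ hqD, vars_var]
      exact Set.disjoint_singleton_right.2 hq
  obtain ⟨d', hd', hprem', hconcl', hbound'⟩ := hS.exists_subst_mem he hσ'_bound hσ'_fresh
  refine ⟨d', hd', ρ, ?_, ?_, hbound'.trans hbound,
    hbound' ▸ hfresh.mono_right fun p hp => .inl (.inl hp)⟩
  · rw [hprem', hprem, substSet, substSet, Set.image_image]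
    refine Set.image_congr fun φ hφ => (subst_subst _ _ _).trans (subst_congr fun p hp => ?_)
    by_cases hpb : p ∈ d.bound
    · simpa [hpb] using hσ'_bound (ρ p) (hbound ▸ Set.mem_image_of_mem ρ hpb)
    · simpa [hpb, hfix p hpb] using hσ' ⟨.inl (vars_subset_varsOf hφ hp), hpb⟩
  · rw [hconcl', hconcl]
    exact subst_congr fun p hp => hσ' ⟨.inr hp, Set.disjoint_right.1 d.bound_concl hp⟩

end IsPi2RuleSystem

/-- The formulas that are derivable in `S` from the premises of `r`, after the bound variables of
`r` have been replaced by `1`. -/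
def derivedTheory (S : Set (Pi2Rule k.lang V)) (r : Pi2Rule k.lang V) : Set (k.lang.Term V) :=
  {φ | ∃ g ∈ S, g.prem = r.prem ∧ g.bound = r.bound ∧ g.concl = φ.subst (eraseVars r.bound)}

variable {S : Set (Pi2Rule k.lang V)} {r : Pi2Rule k.lang V}

theorem concl_mem_derivedTheory_iff : r.concl ∈ derivedTheory S r ↔ r ∈ S := by
  rw [derivedTheory, Set.mem_ofPred_eq, subst_eraseVars r.bound_concl]
  refine ⟨fun ⟨g, hg, hprem, hbound, hconcl⟩ => ?_, fun hr => ⟨r, hr, rfl, rfl, rfl⟩⟩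
  exact Pi2Rule.ext hprem hconcl hbound ▸ hg

theorem subst_mem_derivedTheory_of_mem_prem (hS : IsPi2RuleSystem S) {φ : k.lang.Term V}
    (hφ : φ ∈ r.prem) {σ : V → k.lang.Term V} (hσ : ∀ p ∉ r.bound, σ p = .var p) :
    φ.subst σ ∈ derivedTheory S r :=
  ⟨⟨r.prem, (φ.subst σ).subst (eraseVars r.bound), r.bound, r.prem_finite, r.bound_finite,
    disjoint_vars_subst_eraseVars _ _⟩,
    hS.strong_reflexivity _ φ (fun p => (σ p).subst (eraseVars r.bound)) hφ
      (fun p hp => by rw [hσ p hp]; exact eraseVars_of_notMem hp)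
      (fun _ _ => disjoint_vars_subst_eraseVars _ _) (subst_subst _ _ _), rfl, rfl, rfl⟩

variable [Infinite V]

theorem concl_subst_mem_derivedTheory (hS : IsPi2RuleSystem S) {d : Pi2Rule k.lang V} (hd : d ∈ S)
    (σ : V → k.lang.Term V) (h : ∀ φ ∈ d.prem, ∀ τ : V → k.lang.Term V,
      (∀ p ∉ d.bound, τ p = σ p) → φ.subst τ ∈ derivedTheory S r) :
    d.concl.subst σ ∈ derivedTheory S r := by
  classical
  obtain ⟨e, he, ρ, hprem, hconcl, hbound, hfresh⟩ :=
    hS.exists_substInstance_mem hd (fun p => (σ p).subst (eraseVars r.bound))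
      (r.bound_finite.union (finite_varsOf r.prem_finite))
  refine ⟨⟨r.prem, (d.concl.subst σ).subst (eraseVars r.bound), r.bound, r.prem_finite,
    r.bound_finite, disjoint_vars_subst_eraseVars _ _⟩, ?_, rfl, rfl, rfl⟩
  refine hS.rule_cut e _ he ?_ (hfresh.mono_right Set.subset_union_right)
    ((subst_subst _ _ _).trans hconcl.symm)
  rw [hprem]
  rintro _ ⟨φ, hφ, rfl⟩
  obtain ⟨g, hg, hgprem, hgbound, hgconcl⟩ :=
    h φ hφ (d.bound.piecewise (fun p => .var (ρ p)) σ) (Set.piecewise_eqOn_compl _ _ _)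
  refine ⟨g, hg, hgprem, hgbound, hgconcl.trans <| (subst_subst _ _ _).trans <|
    subst_congr fun p _ => ?_⟩
  by_cases hp : p ∈ d.bound
  · have : ρ p ∉ r.bound := fun h =>
      Set.disjoint_left.1 hfresh (hbound ▸ Set.mem_image_of_mem ρ hp) (.inl h)
    simpa [hp] using eraseVars_of_notMem this
  · simp [hp]

variable {L : Set (k.lang.Term V)}

theorem isDeductiveFilter_derivedTheory (hS : IsPi2RuleSystem S) (hLS : k.rules L ⊆ S) :
    IsDeductiveFilter L (derivedTheory S r) := by
  intro d hd σ h
  rw [realize_eq_subst]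
  refine concl_subst_mem_derivedTheory hS (hLS hd) σ fun φ hφ τ hτ => ?_
  obtain rfl : τ = σ := funext fun p => hτ p (by simp [Kind.bound_of_mem_rules hd])
  exact realize_eq_subst φ τ ▸ h φ hφ

theorem exists_mem_ind_not_validates (hL : k.IsLogic L) (hS : IsPi2RuleSystem S)
    (hLS : k.rules L ⊆ S) (hr : r ∉ S) : ∃ A ∈ ind L S, ¬ Validates A.carrier r := by
  classical
  obtain ⟨A, π, hπ, trueAt_iff⟩ :=
    LAlgebra.exists_quotient hL (isDeductiveFilter_derivedTheory (r := r) hS hLS)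
  simp only [realize_eq_subst] at trueAt_iff
  refine ⟨A, fun d hd v hv => ?_, fun hA => hr (concl_mem_derivedTheory_iff.1 ?_)⟩
  · obtain ⟨σ, rfl : π ∘ σ = v⟩ := hπ.comp_left v
    refine (trueAt_iff σ _).2 (concl_subst_mem_derivedTheory hS hd σ fun φ hφ τ hτ => ?_)
    exact (trueAt_iff τ φ).1 (hv φ hφ _ fun p hp => congrArg π (hτ p hp))
  · rw [← subst_var r.concl, ← trueAt_iff]
    refine hA _ fun φ hφ v hv => ?_
    obtain ⟨σ, rfl : π ∘ σ = v⟩ := hπ.comp_left v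
    have hσ : (fun p => π (r.bound.piecewise σ .var p)) = π ∘ σ := funext fun p => by
      by_cases hp : p ∈ r.bound
      · simp [hp]
      · simpa [hp] using (hv p hp).symm
    refine hσ ▸ (trueAt_iff _ φ).2 ?_
    exact subst_mem_derivedTheory_of_mem_prem hS hφ (Set.piecewise_eqOn_compl _ _ _)

theorem pi2_ind (hL : k.IsLogic L) (hS : IsPi2RuleSystem S) (hLS : k.rules L ⊆ S) :
    pi2 (ind L S) = S := by
  refine Set.Subset.antisymm (fun r hr => ?_) fun r hr A hA => hA r hr
  by_contra hrS
  obtain ⟨A, hA, hAr⟩ := exists_mem_ind_not_validates hL hS hLS hrS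
  exact hAr (hr A hA)

end Completeness

section Diagrams

variable {k : Kind.{u}} {V W : Type u} {L : Set (k.lang.Term V)}

theorem exists_validates_iff [Infinite V] (d : Pi2Rule k.lang W) : ∃ r : Pi2Rule k.lang V,
    ∀ (A : Type u) [k.lang.Structure A], Validates A r ↔ Validates A d := by
  classical
  obtain ⟨g, hg, -⟩ := exists_injOn_mapsTo_compl (β := V)
    ((d.bound_finite.union (finite_varsOf d.prem_finite)).union (finite_vars d.concl))
    Set.finite_empty
  have mem_of_prem {φ p} (hφ : φ ∈ d.prem) (hp : p ∈ vars φ) :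
      p ∈ d.bound ∪ varsOf d.prem ∪ vars d.concl := .inl (.inr (vars_subset_varsOf hφ hp))
  have notMem_image {p} (hp : p ∈ d.bound ∪ varsOf d.prem ∪ vars d.concl) (hpb : p ∉ d.bound) :
      g p ∉ g '' d.bound := by
    rintro ⟨q, hq, hqp⟩
    exact hpb (hg (.inl (.inl hq)) hp hqp ▸ hq)
  have hconcl : Disjoint (g '' d.bound) (vars (d.concl.subst fun p => .var (g p))) := by
    simp only [vars_subst, vars_var, Set.disjoint_iUnion₂_right, Set.disjoint_singleton_right]
    exact fun p hp => notMem_image (.inr hp) (Set.disjoint_right.1 d.bound_concl hp)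
  refine ⟨⟨(·.subst fun p => .var (g p)) '' d.prem, d.concl.subst fun p => .var (g p),
    g '' d.bound, d.prem_finite.image _, d.bound_finite.image _, hconcl⟩,
    fun A _ => ⟨fun hr v hv => ?_, fun hd v hv => trueAt_subst.2 (hd _ fun φ hφ w hw => ?_)⟩⟩
  · have : Nonempty A := ⟨(k.one : A)⟩
    obtain ⟨y, hy⟩ := exists_eqOn_comp hg v
    refine (trueAt_congr fun p hp => hy (.inr hp)).1 <| trueAt_subst.1 <| hr y ?_
    rintro _ ⟨φ, hφ, rfl⟩ w hw
    refine trueAt_subst.2 <| (trueAt_congr fun p hp => ?_).1 <|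
      hv φ hφ _ (Set.piecewise_eqOn_compl d.bound (w ∘ g) v)
    have hp := mem_of_prem hφ hp
    by_cases hpb : p ∈ d.bound
    · simp [hpb]
    · simpa [hpb, hw _ (notMem_image hp hpb)] using (hy hp).symm
  · have : Nonempty A := ⟨(k.one : A)⟩
    obtain ⟨y, hy⟩ := exists_eqOn_comp hg w
    refine (trueAt_congr fun p hp => ?_).1 <| trueAt_subst.1 <|
      hv _ ⟨φ, hφ, rfl⟩ _ (Set.piecewise_eqOn_compl (g '' d.bound) y v)
    have hp := mem_of_prem hφ hp
    by_cases hpb : p ∈ d.bound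
    · simpa [Set.mem_image_of_mem g hpb] using hy hp
    · simp [notMem_image hp hpb, hw p hpb]

theorem validates_of_mem_ind_pi2 [Infinite V] {K : Set (LAlgebra L)} {A : LAlgebra L}
    (hA : A ∈ ind L (pi2 K)) {d : Pi2Rule k.lang W} (hd : ∀ B ∈ K, Validates B.carrier d) :
    Validates A.carrier d := by
  obtain ⟨r, hr⟩ := exists_validates_iff (V := V) d
  exact (hr A.carrier).1 (hA r fun B hB => (hr B.carrier).2 (hd B hB))

section ForallTrue

variable {A B : Type u} [k.lang.Structure B]

/-- `B ⊨ ∀x̄ t(x̄, h(ā)) = 1`, where the term `t` has parameters `ā` from `A`, interpreted by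
`h : A → B`, and variables `x̄` among the natural numbers. -/
def ForallTrue (h : A → B) (t : k.lang.Term (A ⊕ ℕ)) : Prop :=
  ∀ x : ℕ → B, TrueAt (Sum.elim h x) t

/-- The universal equations `t(x̄, ā) = 1` with parameters from `A` that hold in `A`. -/
def forallDiagram (A : Type u) [k.lang.Structure A] : Set (k.lang.Term (A ⊕ ℕ)) :=
  {t | ForallTrue id t}

theorem ForallTrue.pi {I : Type u} {B : I → Type u} [∀ i, k.lang.Structure (B i)]
    {h : ∀ i, A → B i} {t : k.lang.Term (A ⊕ ℕ)} (ht : ∀ i, ForallTrue (h i) t) :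
    ForallTrue (fun a i => h i a) t := by
  intro x
  funext i
  have key : TrueAt ((fun b : ∀ i, B i => b i) ∘ Sum.elim (fun a i => h i a) x) t := by
    rw [Sum.comp_elim]
    exact ht i _
  exact (realize_pi B t _ i).trans (key.trans (map_one (projection B i)).symm)

theorem ForallTrue.ultraproduct {I : Type u} {U : Ultrafilter I} {B : I → Type u}
    [∀ i, k.lang.Structure (B i)] {h : ∀ i, A → B i} {t : k.lang.Term (A ⊕ ℕ)}
    (ht : ∀ᶠ i in U, ForallTrue (h i) t) :
    ForallTrue (fun a => ultraMk U fun i => h i a) t := by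
  intro x
  obtain ⟨x, rfl⟩ := exists_eq_ultraMk_comp x
  have key : TrueAt (ultraMk U ∘ Sum.elim (fun a i => h i a) x) t := by
    refine trueAt_ultraMk_iff.2 <| ht.mono fun i hi => ?_
    change TrueAt ((fun b : ∀ i, B i => b i) ∘ Sum.elim (fun a i => h i a) x) t
    rw [Sum.comp_elim]
    exact hi _
  rwa [Sum.comp_elim] at key

end ForallTrue

section DiagramMap

variable {A B : Type u} [sA : k.lang.Structure A] [sB : k.lang.Structure B]
  (hA : k.IsAlgebra A sA) (hB : k.IsAlgebra B sB) {h : A → B}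
  (hdiag : ∀ t ∈ forallDiagram (k := k) A, ForallTrue h t)
include hA hB hdiag

theorem realize_eq_of_forallDiagram {s t : k.lang.Term (A ⊕ ℕ)}
    (hst : ∀ x : ℕ → A, s.realize (Sum.elim id x) = t.realize (Sum.elim id x)) (x : ℕ → B) :
    s.realize (Sum.elim h x) = t.realize (Sum.elim h x) :=
  hB.trueAt_iff_iff.1 <| hdiag _ (fun y => hA.trueAt_iff_iff.2 (hst y)) x

theorem map_funMap_of_forallDiagram {n : ℕ} (f : k.lang.Functions n) (a : Fin n → A) :
    h (Structure.funMap f a) = Structure.funMap f (h ∘ a) :=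
  realize_eq_of_forallDiagram hA hB hdiag (s := .var (.inl (Structure.funMap f a)))
    (t := .func f fun i => .var (.inl (a i))) (fun _ => rfl) fun _ => (k.one : B)

theorem injective_of_forallDiagram (hone : ∀ a, h a = (k.one : B) → a = (k.one : A)) :
    Function.Injective h := by
  intro a b hab
  let s : k.lang.Term (A ⊕ ℕ) := (k.connectives _).iff (.var (.inl a)) (.var (.inl b))
  have hs := realize_eq_of_forallDiagram hA hB hdiag (s := s)
    (t := .var (.inl ((k.connectives A).iff a b))) (fun _ => realize_iff _ _ _)
    fun _ => (k.one : B)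
  exact hA.iff_eq_one_iff.1 (hone _ (hs.symm.trans (hB.trueAt_iff_iff.2 hab)))

theorem exists_isForallEmbedding (hone : ∀ a, h a = (k.one : B) → a = (k.one : A)) :
    ∃ f : A ↪[k.lang] B, IsForallEmbedding f := by
  let f : A ↪[k.lang] B :=
    { toFun := h
      inj' := injective_of_forallDiagram hA hB hdiag hone
      map_fun' := map_funMap_of_forallDiagram hA hB hdiag
      map_rel' := fun r => isEmptyElim r }
  refine ⟨f, isForallEmbedding_iff.2 fun m n s t a hst x => ?_⟩
  let g : Fin m ⊕ Fin n → A ⊕ ℕ := Sum.elim (.inr ∘ Fin.val) (.inl ∘ a)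
  have realize_relabel {C : Type u} [k.lang.Structure C] (c : A → C) (y : ℕ → C)
      (r : k.lang.Term (Fin m ⊕ Fin n)) : (r.relabel g).realize (Sum.elim c y) =
        r.realize (Sum.elim (y ∘ Fin.val) (c ∘ a)) := by
    rw [Term.realize_relabel, Sum.comp_elim]
    rfl
  have key := realize_eq_of_forallDiagram hA hB hdiag (s := s.relabel g) (t := t.relabel g)
    (fun y => by simpa only [realize_relabel, Function.id_comp] using hst (y ∘ Fin.val))
    (Function.extend Fin.val x fun _ => k.one)
  rwa [realize_relabel, realize_relabel, Function.extend_comp Fin.val_injective] at key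

end DiagramMap

variable [Infinite V] {K : Set (LAlgebra L)} {A : LAlgebra L}

/-- Otherwise the rule with premises `Γ`, whose parameters are free and whose variables are bound,
and with conclusion `a` would be valid in `K` but not in `A`. -/
theorem exists_mem_forallTrue_ne_one (hA : A ∈ ind L (pi2 K))
    {Γ : Set (k.lang.Term (A.carrier ⊕ ℕ))} (hΓ : Γ.Finite)
    (hΓA : Γ ⊆ forallDiagram A.carrier) {a : A.carrier} (ha : a ≠ (k.one : A.carrier)) :
    ∃ B ∈ K, ∃ h : A.carrier → B.carrier,
      (∀ t ∈ Γ, ForallTrue h t) ∧ h a ≠ (k.one : B.carrier) := by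
  classical
  by_contra! hK
  let d : Pi2Rule k.lang (A.carrier ⊕ ℕ) :=
    { prem := Γ
      concl := .var (.inl a)
      bound := varsOf Γ ∩ Set.range .inr
      prem_finite := hΓ
      bound_finite := (finite_varsOf hΓ).inter_of_left _
      bound_concl := by simp [vars_var] }
  have inl_notMem (b : A.carrier) : .inl b ∉ d.bound := by simp [d]
  have hdK : ∀ B ∈ K, Validates B.carrier d := by
    refine fun B hB v hv => hK B hB (v ∘ .inl) fun t ht x => ?_
    refine (trueAt_congr ?_).1 <|
      hv t ht _ (Set.piecewise_eqOn_compl d.bound (Sum.elim (v ∘ .inl) x) v)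
    rintro (b | n) hp
    · simp [inl_notMem]
    · have : .inr n ∈ d.bound := ⟨vars_subset_varsOf ht hp, n, rfl⟩
      simp [this]
  refine ha (validates_of_mem_ind_pi2 hA hdK (Sum.elim id fun _ => k.one) fun t ht v hv => ?_)
  have : v = Sum.elim id (v ∘ .inr) := funext fun
    | .inl b => hv _ (inl_notMem b)
    | .inr _ => rfl
  exact this ▸ hΓA ht _

theorem exists_mem_forallTrue_reflecting_one (hL : k.IsLogic L) (hK : IsInductiveRuleClass K)
    (hA : A ∈ ind L (pi2 K)) {Γ : Set (k.lang.Term (A.carrier ⊕ ℕ))} (hΓ : Γ.Finite)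
    (hΓA : Γ ⊆ forallDiagram A.carrier) : ∃ B ∈ K, ∃ h : A.carrier → B.carrier,
      (∀ t ∈ Γ, ForallTrue h t) ∧ ∀ a, h a = (k.one : B.carrier) → a = (k.one : A.carrier) := by
  choose B hB h hΓB ha using fun a : {a : A.carrier // a ≠ (k.one : A.carrier)} =>
    exists_mem_forallTrue_ne_one hA hΓ hΓA a.2
  refine ⟨LAlgebra.pi hL B, hK.prod _ B _ hB ⟨.refl k.lang (∀ a, (B a).carrier)⟩,
    fun b a => h a b, fun t ht => .pi fun a => hΓB a t ht, fun b hb => ?_⟩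
  by_contra hne
  refine ha ⟨b, hne⟩ ((congrFun hb ⟨b, hne⟩).trans ?_)
  exact map_one (projection (ℒ := k.lang) (fun a => (B a).carrier) ⟨b, hne⟩)

theorem ind_pi2 (hL : k.IsLogic L) (hK : IsInductiveRuleClass K) : ind L (pi2 K) = K := by
  classical
  refine Set.Subset.antisymm (fun A hA => ?_) fun A hA r hr => hr A hA
  let I : Type u := Finset (forallDiagram (k := k) A.carrier)
  choose B hB h hdiag hone using fun Γ : I =>
    exists_mem_forallTrue_reflecting_one hL hK hA (Γ.finite_toSet.image Subtype.val)
      (Subtype.coe_image_subset _ _)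
  let U : Ultrafilter I := .of Filter.atTop
  let h_ultra : A.carrier → (LAlgebra.ultraproduct hL B U).carrier :=
    fun a => ultraMk U fun i => h i a
  have hdiag_ultra : ∀ t ∈ forallDiagram A.carrier, ForallTrue (k := k) h_ultra t := fun t ht => by
    refine .ultraproduct ?_
    filter_upwards [Ultrafilter.of_le _ (Filter.eventually_ge_atTop {⟨t, ht⟩})] with i hi
    exact hdiag i t ⟨_, hi (Finset.mem_singleton_self _), rfl⟩
  have hone_ultra (a : A.carrier) (ha : h_ultra a = k.one) : a = (k.one : A.carrier) := by
    obtain ⟨i, hi⟩ :=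
      (trueAt_ultraMk_iff (φ := .var PUnit.unit) (v := fun _ i => h i a).1 ha).exists
    exact hone i a hi
  obtain ⟨f, hf⟩ := exists_isForallEmbedding A.isAlgebra
    (LAlgebra.ultraproduct hL B U).isAlgebra hdiag_ultra hone_ultra
  exact hK.forall_sub A _ f hf <| hK.ultraprod I U B _ hB
    ⟨.refl k.lang ((U : Filter I).Product fun i => (B i).carrier)⟩

end Diagrams

section DualIsomorphism

variable {k : Kind.{u}} {V : Type u} [Infinite V] {L : Set (k.lang.Term V)}

/-- The dual isomorphism `Ind` between the lattice of `Π₂`-rule systems extending `L` and that of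
inductive rule classes of `L`-algebras; its inverse is `Π₂`. -/
def indOrderIso (hL : k.IsLogic L) : RuleSystem L ≃o (InductiveRuleClass L)ᵒᵈ where
  toFun S := OrderDual.toDual ⟨ind L S.1, isInductiveRuleClass_ind L S.1⟩
  invFun K := ⟨pi2 (OrderDual.ofDual K).1, isPi2RuleSystem_pi2 _,
    fun _ hr A _ => A.validates_rules hr⟩
  left_inv S := Subtype.ext (pi2_ind hL S.2.1 S.2.2)
  right_inv K := congrArg OrderDual.toDual (Subtype.ext (ind_pi2 hL (OrderDual.ofDual K).2))
  map_rel_iff' {S T} := by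
    change ind L T.1 ⊆ ind L S.1 ↔ S.1 ⊆ T.1
    refine ⟨fun h r hr => ?_, fun h A hA r hr => hA r (h hr)⟩
    rw [← pi2_ind hL T.2.1 T.2.2]
    exact fun A hA => h hA r hr

end DualIsomorphism

end PiTwo

theorem mainTheorem1 {k : PiTwo.Kind.{u}} {V : Type u} [Infinite V]
    (L : Set (k.lang.Term V)) (hL : k.IsLogic L) :
    ∃ e : PiTwo.RuleSystem L ≃o (PiTwo.InductiveRuleClass L)ᵒᵈ,
      (∀ S : PiTwo.RuleSystem L, (OrderDual.ofDual (e S)).1 = PiTwo.ind L S.1) ∧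
      (∀ K : PiTwo.InductiveRuleClass L,
        (e.symm (OrderDual.toDual K)).1 = PiTwo.pi2 K.1) ∧
      (∀ S T : PiTwo.RuleSystem L,
        PiTwo.ind L (S.1 ∩ T.1) =
          PiTwo.inductiveClosure (PiTwo.ind L S.1 ∪ PiTwo.ind L T.1)) ∧
      (∀ S T : PiTwo.RuleSystem L,
        PiTwo.ind L (PiTwo.ruleClosure (S.1 ∪ T.1)) =
          PiTwo.ind L S.1 ∩ PiTwo.ind L T.1) := by
  let e := PiTwo.indOrderIso hL
  have val_eq {K M : (PiTwo.InductiveRuleClass L)ᵒᵈ} (h : K = M) :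
      (OrderDual.ofDual K).1 = (OrderDual.ofDual M).1 := h ▸ rfl
  exact ⟨e, fun _ => rfl, fun _ => rfl, fun S T => val_eq (e.map_inf S T),
    fun S T => val_eq (e.map_sup S T)⟩
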